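/- Let $E,A\in\mathbb R^{n\times n}$, $B\in\mathbb R^{n\times m}$, $C\in\mathbb R^{p\times n}$, $D\in\mathbb R^{p\times m}$ and consider the descriptor system $$Ex(t+1)=Ax(t)+Bu(t),\qquad y(t)=Cx(t)+Du(t),$$ assumed regular ($\det(\lambda E-A)\ne0$ for some $\lambda\in\mathbb C$), R-controllable ($\operatorname{rk}[\lambda E-A,\ B]=n$ for all $\lambda\in\mathbb C$) and R-observable ($\operatorname{rk}\begin{bmatrix}\lambda E-A\\ C\end{bmatrix}=n$ for all $\lambda\in\mathbb C$). Let $SEP=\operatorname{diag}(I_q,N)$, $SAP=\operatorname{diag}(A_1,I_r)$ be a quasi-Weierstraß form with $S,P$ invertible and $N$ nilpotent, let $s\ge1$ be the least positive integer with $N^s=0$ ($q$ and $s$ do not depend on the form), and put $h=q+s-1$. A trajectory of the system on a (finite or infinite) interval of integers beginning at $a$ is the restriction to that interval of $(x,u,y)(\cdot-a)$, where $(x,u,y)$ satisfies the system equations on $\mathbb N_0$; $(u,y)$ is then called an input-output trajectory. Let $Q\in\mathbb R^{p\times p}$ and $R\in\mathbb R^{m\times m}$ be symmetric positive definite and let $L\ge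 2q+3s-2$. Let $(\bar u,\bar y)$ be an input-output trajectory on $[0,T-1]$ such that $\bar u$ is persistently exciting of order $L+2(q+s-1)$, i.e. the Hankel matrix $H_{L+2(q+s-1)}(\bar u_{[0,T-1]})$ has rank $m(L+2(q+s-1))$. The optimal control problem (OCP) at time $t\ge 0$, given a measured window $(u,y)|_{[t-h,t-1]}$, is to minimize $$\sum_{k=0}^{L-1}\hat y(t+k)^\top Q\,\hat y(t+k)+\hat u(t+k)^\top R\,\hat u(t+k)$$ over $(\hat u,\hat y)$ on $[t-h,t+L-1]$ and vectors $\alpha$ subject to $$\begin{bmatrix}\hat{\mathbf u}_{[t-h,t+L-1]}\\ \hat{\mathbf y}_{[t-h,t+L-1]}\end{bmatrix}=\begin{bmatrix}H_{L+h}(\bar{\mathbf u}_{[0,T-s]})\\ H_{L+h}(\bar{\mathbf y}_{[0,T-s]})\end{bmatrix}\alpha,$$ $(\hat u,\hat y)=(u,y)$ on $[t-h,t-1]$ and $(\hat u,\hat y)=(0,0)$ on $[t+L-h,t+L-1]$. Receding-horizon scheme: starting with a measured window on $[-h,-1]$, at each time $t=0,1,2,\dots$ an optimal solution $(u^\star,y^\star,\alpha^\star)$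 of the OCP is computed for the window on $[t-h,t-1]$, the input $u(t)=u^\star(t)$ is applied, and the output $y(t)$ of the system is measured. Since $y(t)$ may depend on $u(t),\dots,u(t+s-1)$, it is understood as the output at time $t$ of an input-output trajectory on $[-h,\infty)$ which continues the signals $(u,y)|_{[-h,t-1]}$ realized so far and has the currently planned inputs $u^\star(t),\dots,u^\star(t+L-1)$ on $[t,t+L-1]$. Then the following hold. 1. (Recursive feasibility) If the OCP is feasible at time $t=0$, then for every $t\in\mathbb N_0$ and every run of the scheme at the times $0,\dots,t-1$, the OCP is feasible at time $t$, and the run can be continued to a run at all times. 2. Every run $(u,y)$ of the scheme at all times is an input-output trajectory of the system on $[-h,\infty)$. A trajectory $(x,u,y)$ of the system on $[-h,\infty)$ for which $(u,y)$ is such a run is called a closed-loop trajectory. 3. (Asymptotic stability of the origin) For every $\varepsilon>0$ there is $\delta>0$ such that every closed-loop trajectory with $\|(Ex)(0)\|<\delta$ or $\|(u,y)|_{[-h,-1]}\|<\delta$ satisfies $\|(x(t),u(t),y(t))\|<\varepsilon$ for all $t\ge0$. Moreover, the domain of attraction, i.e. the set of initial windows on $[-h,-1]$ from which there is a closed-loop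 trajectory and from which every closed-loop trajectory satisfies $(x(t),u(t),y(t))\to0$ as $t\to\infty$, is exactly the set of feasible consistent initial values, i.e. of the input-output trajectories on $[-h,-1]$ for which the OCP at time $t=0$ is feasible. -/

import Mathlib

open Filter Topology

/-- Data of a discrete-time linear descriptor system
`E x(t+1) = A x(t) + B u(t)`, `y(t) = C x(t) + D u(t)`. -/
structure DescriptorSystem (n m p : ℕ) where
  E : Matrix (Fin n) (Fin n) ℝ
  A : Matrix (Fin n) (Fin n) ℝ
  B : Matrix (Fin n) (Fin m) ℝ
  C : Matrix (Fin p) (Fin n) ℝ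
  D : Matrix (Fin p) (Fin m) ℝ

namespace DescriptorSystem

variable {n m p : ℕ} (sys : DescriptorSystem n m p)

/-- The matrix `λ E - A` over the complex numbers. -/
noncomputable def pencil (lam : ℂ) : Matrix (Fin n) (Fin n) ℂ :=
  lam • sys.E.map (algebraMap ℝ ℂ) - sys.A.map (algebraMap ℝ ℂ)

/-- Regularity: `det (λ E - A) ≠ 0` for some complex `λ`. -/
def IsRegular : Prop := ∃ lam : ℂ, (sys.pencil lam).det ≠ 0

/-- R-controllability: `rk [λ E - A, B] = n` for all complex `λ`. -/
def IsRControllable : Prop :=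
  ∀ lam : ℂ, (Matrix.fromCols (sys.pencil lam) (sys.B.map (algebraMap ℝ ℂ))).rank = n

/-- R-observability: `rk [λ E - A; C] = n` for all complex `λ`. -/
def IsRObservable : Prop :=
  ∀ lam : ℂ, (Matrix.fromRows (sys.pencil lam) (sys.C.map (algebraMap ℝ ℂ))).rank = n

/-- The system has a quasi-Weierstrass form `S E P = diag(I_q, N)`, `S A P = diag(A₁, I_r)` with
invertible `S`, `P`, where `A₁` has size `q` and `N` is nilpotent of nilpotency index `s`,
the least `s ≥ 1` with `N ^ s = 0` (so that `s = 1` if `E` is invertible, i.e. `r = 0`). -/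
def HasQuasiWeierstrassForm (q s : ℕ) : Prop :=
  ∃ (r : ℕ) (e : Fin q ⊕ Fin r ≃ Fin n) (S P : Matrix (Fin n) (Fin n) ℝ)
    (A₁ : Matrix (Fin q) (Fin q) ℝ) (N : Matrix (Fin r) (Fin r) ℝ),
    IsUnit S.det ∧ IsUnit P.det ∧
    S * sys.E * P = Matrix.reindex e e (Matrix.fromBlocks 1 0 0 N) ∧
    S * sys.A * P = Matrix.reindex e e (Matrix.fromBlocks A₁ 0 0 1) ∧
    IsLeast {k : ℕ | 1 ≤ k ∧ N ^ k = 0} s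

/-- The dimension `q` of the dynamic part in the quasi-Weierstrass form. For a regular system the
form exists and `q` does not depend on it, so the set below is a singleton. -/
noncomputable def q : ℕ := sInf {q : ℕ | ∃ s : ℕ, sys.HasQuasiWeierstrassForm q s}

/-- The nilpotency index `s` in the quasi-Weierstrass form. For a regular system the form exists
and `s` does not depend on it, so the set below is a singleton. -/
noncomputable def s : ℕ := sInf {s : ℕ | sys.HasQuasiWeierstrassForm sys.q s}

/-- The full behavior: all trajectories `(x, u, y)` of the system on `ℕ`. -/
def fullBehavior :
    Set ((ℕ → Fin n → ℝ) × (ℕ → Fin m → ℝ) × (ℕ → Fin p → ℝ)) :=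
  {b | ∀ t : ℕ,
    sys.E.mulVec (b.1 (t + 1)) = sys.A.mulVec (b.1 t) + sys.B.mulVec (b.2.1 t) ∧
    b.2.2 t = sys.C.mulVec (b.1 t) + sys.D.mulVec (b.2.1 t)}

/-- The manifest behavior: all input-output trajectories `(u, y)` of the system on `ℕ`. -/
def manifestBehavior : Set ((ℕ → Fin m → ℝ) × (ℕ → Fin p → ℝ)) :=
  {b | ∃ x : ℕ → Fin n → ℝ, (x, b.1, b.2) ∈ sys.fullBehavior}

/-- The restriction of the manifest behavior to the `T` time instants `0, …, T - 1`. -/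
def restrictedManifestBehavior (T : ℕ) : Set ((Fin T → Fin m → ℝ) × (Fin T → Fin p → ℝ)) :=
  {w | ∃ b ∈ sys.manifestBehavior, (∀ k : Fin T, w.1 k = b.1 k) ∧ (∀ k : Fin T, w.2 k = b.2 k)}

end DescriptorSystem

/-- The Hankel matrix with `K` block rows of the signal `f(0), …, f(T - 1)`;
it has `T - K + 1` columns (none if `T < K`). -/
def hankelMatrix {d : ℕ} (K T : ℕ) (f : ℕ → Fin d → ℝ) :
    Matrix (Fin K × Fin d) (Fin (T + 1 - K)) ℝ :=
  Matrix.of fun i j => f (i.1 + j) i.2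

/-- The vectorization of the signal `f(0), …, f(K - 1)`. -/
def stackedVector {d : ℕ} (K : ℕ) (f : ℕ → Fin d → ℝ) : Fin K × Fin d → ℝ :=
  fun i => f i.1 i.2

/-- The signal `u(0), …, u(T - 1)` is persistently exciting of order `K`. -/
def IsPersistentlyExciting {m : ℕ} (T : ℕ) (u : ℕ → Fin m → ℝ) (K : ℕ) : Prop :=
  (hankelMatrix K T u).rank = m * K

/-- All the data of the predictive control scheme: the system, the weights `Q`, `R`, the
prediction horizon `L`, and the recorded data `ubar, ybar`, of which only the samples at
`0, …, T - 1` are used. -/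
structure MPCScheme (n m p : ℕ) where
  sys : DescriptorSystem n m p
  Q : Matrix (Fin p) (Fin p) ℝ
  R : Matrix (Fin m) (Fin m) ℝ
  L : ℕ
  T : ℕ
  ubar : ℕ → Fin m → ℝ
  ybar : ℕ → Fin p → ℝ

namespace MPCScheme

variable {n m p : ℕ} (M : MPCScheme n m p)

/-- The number `q + s - 1` of past samples that are measured. -/
noncomputable def h : ℕ := M.sys.q + M.sys.s - 1

/-- Measured past input-output samples, at the times `t - h, …, t - 1`. -/
abbrev Window : Type := (Fin M.h → Fin m → ℝ) × (Fin M.h → Fin p → ℝ)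

/-- Signals of the closed loop live on the times `-h, -h + 1, …` and are stored with their index
shifted by `h`, that is, the value at time `τ` is stored at index `τ + h`. The window
available at time `t` thus consists of the indices `t, …, t + h - 1`. -/
def window (u : ℕ → Fin m → ℝ) (y : ℕ → Fin p → ℝ) (t : ℕ) : M.Window :=
  (fun i => u (t + i), fun i => y (t + i))

/-- The number of columns of the Hankel matrix with `L + h` block rows of the samples
`0, …, T - s`. -/
noncomputable abbrev numCols : ℕ := (M.T + 1 - M.sys.s) + 1 - (M.L + M.h)

/-- Feasibility of `(uh, yh, α)` for the data-driven optimal control problem with measured window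
`w`. The predicted signals `uh, yh` live on the times `t - h, …, t + L - 1`, stored at the indices
`0, …, L + h - 1`; no other values of them are used. -/
structure IsFeasiblePoint (w : M.Window) (uh : ℕ → Fin m → ℝ) (yh : ℕ → Fin p → ℝ)
    (α : Fin M.numCols → ℝ) : Prop where
  input_eq : stackedVector (M.L + M.h) uh
    = (hankelMatrix (M.L + M.h) (M.T + 1 - M.sys.s) M.ubar).mulVec α
  output_eq : stackedVector (M.L + M.h) yh
    = (hankelMatrix (M.L + M.h) (M.T + 1 - M.sys.s) M.ybar).mulVec α
  initial : ∀ i : Fin M.h, uh i = w.1 i ∧ yh i = w.2 i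
  terminal : ∀ i : ℕ, M.L ≤ i → i < M.L + M.h → uh i = 0 ∧ yh i = 0

/-- The optimal control problem with measured window `w` is feasible. -/
def IsFeasible (w : M.Window) : Prop := ∃ uh yh α, M.IsFeasiblePoint w uh yh α

/-- The cost: the sum of `‖yh(t+k)‖_Q ^ 2 + ‖uh(t+k)‖_R ^ 2` over `k = 0, …, L - 1`. -/
noncomputable def cost (uh : ℕ → Fin m → ℝ) (yh : ℕ → Fin p → ℝ) : ℝ :=
  ∑ k ∈ Finset.range M.L,
    (dotProduct (yh (M.h + k)) (M.Q.mulVec (yh (M.h + k)))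
      + dotProduct (uh (M.h + k)) (M.R.mulVec (uh (M.h + k))))

/-- `(uh, yh, α)` is an optimal solution of the problem with measured window `w`. -/
def IsOptimal (w : M.Window) (uh : ℕ → Fin m → ℝ) (yh : ℕ → Fin p → ℝ)
    (α : Fin M.numCols → ℝ) : Prop :=
  M.IsFeasiblePoint w uh yh α ∧
    ∀ uh₂ yh₂ α₂, M.IsFeasiblePoint w uh₂ yh₂ α₂ → M.cost uh yh ≤ M.cost uh₂ yh₂

/-- `(u, y)` results from the receding-horizon scheme at time `t`: an optimal solution for the
window measured at time `t` is computed, its first input is applied, and `y(t)` is the output of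
the system at time `t`. As `y(t)` may depend on `u(t), …, u(t + s - 1)`, it is the output,
continuing the trajectory realized so far, for the input sequence planned at time `t`. -/
def IsStep (u : ℕ → Fin m → ℝ) (y : ℕ → Fin p → ℝ) (t : ℕ) : Prop :=
  ∃ uh yh α, M.IsOptimal (M.window u y t) uh yh α ∧
    ∃ upl ypl, (upl, ypl) ∈ M.sys.manifestBehavior ∧
      (∀ k < t + M.h, upl k = u k ∧ ypl k = y k) ∧
      (∀ k < M.L, upl (t + M.h + k) = uh (M.h + k)) ∧
      u (t + M.h) = uh M.h ∧
      y (t + M.h) = ypl (t + M.h)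

/-- `(u, y)` results from the receding-horizon scheme at the times `0, …, t - 1`. -/
def IsRunUpTo (u : ℕ → Fin m → ℝ) (y : ℕ → Fin p → ℝ) (t : ℕ) : Prop :=
  ∀ k < t, M.IsStep u y k

/-- `(u, y)` results from the receding-horizon scheme at all times. -/
def IsRun (u : ℕ → Fin m → ℝ) (y : ℕ → Fin p → ℝ) : Prop :=
  ∀ t, M.IsStep u y t

/-- Trajectories of the closed loop, with the internal state `x`. -/
def IsClosedLoop (x : ℕ → Fin n → ℝ) (u : ℕ → Fin m → ℝ) (y : ℕ → Fin p → ℝ) : Prop :=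
  (x, u, y) ∈ M.sys.fullBehavior ∧ M.IsRun u y

/-- The origin is stable for the closed loop: state, input and output stay small at all times
`t ≥ 0` if the initial value is small, be it `(E x)(0)` or the measured initial window. -/
def IsStable : Prop :=
  ∀ ε > 0, ∃ δ > 0, ∀ x u y, M.IsClosedLoop x u y →
    (‖M.sys.E.mulVec (x M.h)‖ < δ ∨ ‖M.window u y 0‖ < δ) →
    ∀ t, ‖(x (t + M.h), u (t + M.h), y (t + M.h))‖ < ε

/-- The domain of attraction of the origin: the initial windows from which the closed loop runs
for all times and from which all closed-loop trajectories converge to the origin. -/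
def domainOfAttraction : Set M.Window :=
  {w | (∃ x u y, M.IsClosedLoop x u y ∧ M.window u y 0 = w) ∧
    ∀ x u y, M.IsClosedLoop x u y → M.window u y 0 = w →
      Tendsto (fun t => (x (t + M.h), u (t + M.h), y (t + M.h))) atTop (𝓝 0)}

/-- The feasible consistent initial values. -/
def feasibleInitialValues : Set M.Window :=
  {w | w ∈ M.sys.restrictedManifestBehavior M.h ∧ M.IsFeasible w}

end MPCScheme

/-! In quasi-Weierstraß coordinates the fast state is a finite sum over u(t), …, u(t+s-1). The
input-output behavior is therefore that of a q-dimensional state space system whose output looks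
ahead s - 1 steps. The Hautus test, applied to the pencil and to its transpose, makes this slow
subsystem observable and controllable. By observability, h = q + s - 1 samples of (u, y) determine
the slow state, so trajectories that agree on h consecutive samples can be glued (`exists_concat`).
By controllability, keeping s - 1 inputs preserves E x and q further inputs steer the slow state to
zero (`exists_null_control`).

Persistent excitation yields the fundamental lemma `exists_hankel_iff`: the Hankel columns span
exactly the trajectories of length L + h. Since the terminal window has length h, feasible points
are the beginnings of trajectories that vanish from then on (`IsPlan`). As L ≥ 2h, null control
makes every window of a trajectory feasible, and recursive feasibility follows. Minimizers exist by
compactness, because Q and R are positive definite.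

The optimal value is a Lyapunov function (`exists_value`): the measured output equals the predicted
one, so the shifted plan is feasible at the next time and saves the first stage cost. Stage costs
along a run are thus bounded by the initial value and tend to zero. They control the whole state,
since x(t) is a linear function of q + s consecutive samples (`exists_stage_small`). For stability,
a linear section shows that a small window, or a small E x, admits a plan of small cost. -/

/-- A state space system `x(t+1) = A x(t) + B u(t)` whose output
`y(t) = C x(t) + ∑ i < s, G i u(t+i)` may look ahead `s - 1` time steps. -/
structure LookaheadSystem (X U Y : Type*) [AddCommGroup X] [Module ℝ X] [AddCommGroup U]
    [Module ℝ U] [AddCommGroup Y] [Module ℝ Y] where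
  A : X →ₗ[ℝ] X
  B : U →ₗ[ℝ] X
  C : X →ₗ[ℝ] Y
  G : ℕ → U →ₗ[ℝ] Y
  s : ℕ

/-! ### State space systems with look-ahead: observability, steering, persistent excitation. -/

namespace LookaheadSystem

variable {X U Y : Type*} [AddCommGroup X] [Module ℝ X] [AddCommGroup U]
    [Module ℝ U] [AddCommGroup Y] [Module ℝ Y] (S : LookaheadSystem X U Y)

/-- The state at time `t`, as a linear function of the initial state and the input. -/
def state : ℕ → (X × (ℕ → U)) →ₗ[ℝ] X
  | 0 => LinearMap.fst ℝ X (ℕ → U)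
  | t + 1 => S.A ∘ₗ state t + S.B ∘ₗ LinearMap.proj t ∘ₗ LinearMap.snd ℝ X (ℕ → U)

/-- The output at time `t`, as a linear function of the initial state and the input. -/
def out (t : ℕ) : (X × (ℕ → U)) →ₗ[ℝ] Y :=
  S.C ∘ₗ S.state t +
    ∑ i ∈ Finset.range S.s, S.G i ∘ₗ LinearMap.proj (t + i) ∘ₗ LinearMap.snd ℝ X (ℕ → U)

@[simp] lemma state_zero (ξ : X) (u : ℕ → U) : S.state 0 (ξ, u) = ξ := rfl

lemma state_succ (t : ℕ) (ξ : X) (u : ℕ → U) :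
    S.state (t + 1) (ξ, u) = S.A (S.state t (ξ, u)) + S.B (u t) := rfl

lemma out_apply (t : ℕ) (ξ : X) (u : ℕ → U) :
    S.out t (ξ, u) = S.C (S.state t (ξ, u)) + ∑ i ∈ Finset.range S.s, S.G i (u (t + i)) := by
  simp [out, LinearMap.sum_apply]

lemma eq_state {x : ℕ → X} {u : ℕ → U} (h : ∀ t, x (t + 1) = S.A (x t) + S.B (u t)) (t : ℕ) :
    x t = S.state t (x 0, u) := by
  induction t with
  | zero => rfl
  | succ t ih => rw [h, state_succ, ih]

lemma state_congr {t : ℕ} {u v : ℕ → U} (h : ∀ k < t, u k = v k) (ξ : X) :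
    S.state t (ξ, u) = S.state t (ξ, v) := by
  induction t with
  | zero => rfl
  | succ t ih =>
    rw [state_succ, state_succ, ih fun k hk => h k (hk.trans t.lt_succ_self), h t t.lt_succ_self]

lemma state_add (t k : ℕ) (ξ : X) (u : ℕ → U) :
    S.state (t + k) (ξ, u) = S.state k (S.state t (ξ, u), fun i => u (t + i)) := by
  induction k with
  | zero => rfl
  | succ k ih => rw [← add_assoc, state_succ, state_succ, ih]

lemma out_congr {t : ℕ} {u v : ℕ → U} (h : ∀ k < t + S.s, u k = v k) (ξ : X) :
    S.out t (ξ, u) = S.out t (ξ, v) := by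
  rw [out_apply, out_apply, S.state_congr fun k hk => h k (by omega)]
  congr 1
  refine Finset.sum_congr rfl fun i hi => ?_
  rw [h _ (by have := Finset.mem_range.1 hi; omega)]

lemma out_add (t k : ℕ) (ξ : X) (u : ℕ → U) :
    S.out (t + k) (ξ, u) = S.out k (S.state t (ξ, u), fun i => u (t + i)) := by
  simp only [out_apply, state_add, add_assoc]

lemma state_zero_input (t : ℕ) (ξ : X) {u : ℕ → U} (h : ∀ k < t, u k = 0) :
    S.state t (ξ, u) = (S.A ^ t) ξ := by
  induction t with
  | zero => rfl
  | succ t ih =>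
    rw [state_succ, ih fun k hk => h k (by omega), h t (by omega), map_zero, add_zero, pow_succ']
    rfl

/-- Observability in `q` steps. -/
def Observable (q : ℕ) : Prop := ∀ ξ : X, (∀ i < q, S.C ((S.A ^ i) ξ) = 0) → ξ = 0

/-- Controllability in `q` steps, in dual form. -/
def Controllable (q : ℕ) : Prop :=
  ∀ φ : Module.Dual ℝ X, (∀ i < q, ∀ v, φ ((S.A ^ i) (S.B v)) = 0) → φ = 0

variable {S}

/-- A trajectory whose input and output vanish for `q + s - 1` time steps starts at zero. -/
lemma Observable.eq_zero {q : ℕ} (hobs : S.Observable q) {ξ : X} {u : ℕ → U}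
    (hu : ∀ k < q + S.s - 1, u k = 0) (hy : ∀ k < q + S.s - 1, S.out k (ξ, u) = 0)
    (hs : 1 ≤ S.s) : ξ = 0 := by
  refine hobs ξ fun i hi => ?_
  have h := hy i (by omega)
  rw [out_apply, S.state_zero_input i ξ fun k hk => hu k (by omega), Finset.sum_eq_zero,
    add_zero] at h
  · exact h
  · intro k hk
    rw [hu _ (by have := Finset.mem_range.1 hk; omega), map_zero]

/-- Two trajectories that agree for `q + s - 1` time steps have the same initial state. -/
lemma Observable.state_unique {q : ℕ} (hobs : S.Observable q) {ξ ζ : X} {u v : ℕ → U}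
    (hu : ∀ k < q + S.s - 1, u k = v k)
    (hy : ∀ k < q + S.s - 1, S.out k (ξ, u) = S.out k (ζ, v)) (hs : 1 ≤ S.s) : ξ = ζ := by
  refine sub_eq_zero.1 (hobs.eq_zero (u := u - v) (fun k hk => ?_) (fun k hk => ?_) hs)
  · simp [hu k hk]
  · rw [← Prod.mk_sub_mk, map_sub, hy k hk, sub_self]

/-- A trajectory that starts at zero with vanishing input vanishes. -/
lemma out_eq_zero {u : ℕ → U} {t : ℕ} (hu : ∀ k < t + S.s, u k = 0) : S.out t (0, u) = 0 := by
  rw [S.out_congr (v := 0) hu, Prod.mk_zero_zero, map_zero]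

/-- A controllable system can be steered to zero in `q` steps. -/
lemma Controllable.exists_state_eq_zero {q : ℕ} (hctrl : S.Controllable q) (ξ : X) :
    ∃ u : ℕ → U, S.state q (ξ, u) = 0 := by
  have hR : LinearMap.range (S.state q ∘ₗ LinearMap.inr ℝ X (ℕ → U)) = ⊤ := by
    by_contra hne
    obtain ⟨φ, hφ, hle⟩ := Submodule.exists_le_ker_of_lt_top _ (lt_top_iff_ne_top.2 hne)
    refine hφ (hctrl φ fun i hi v => ?_)
    -- An impulse v at time q - 1 - i arrives at time q as A^i B v, so a functional vanishing on the
    -- reachable space annihilates all A^i B with i < q.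
    have h1 : S.state q (0, Pi.single (q - 1 - i) v) = (S.A ^ i) (S.B v) := by
      have hq : q = (q - 1 - i) + 1 + i := by omega
      conv_lhs => rw [hq]
      rw [state_add, S.state_zero_input, state_succ, S.state_zero_input, map_zero, map_zero,
        zero_add]
      · simp
      · intro k hk
        rw [Pi.single_eq_of_ne (by omega)]
      · intro k _
        rw [Pi.single_eq_of_ne (by omega)]
    rw [← h1]
    exact hle ⟨Pi.single (q - 1 - i) v, rfl⟩
  obtain ⟨u, hu⟩ := hR ▸ Submodule.mem_top (x := -S.state q (ξ, 0))
  refine ⟨u, ?_⟩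
  have h2 : ((ξ, u) : X × (ℕ → U)) = (ξ, 0) + (0, u) := by simp
  rw [h2, map_add]
  have h3 : S.state q (0, u) = -S.state q (ξ, 0) := hu
  rw [h3, add_neg_cancel]

/-- Steering to zero after an initial segment with prescribed input. -/
lemma Controllable.exists_input {q : ℕ} (hctrl : S.Controllable q) (ξ : X) (u : ℕ → U) (t : ℕ) :
    ∃ v : ℕ → U, (∀ k < t, v k = u k) ∧ (∀ k, t + q ≤ k → v k = 0) ∧
      ∀ k, t + q ≤ k → S.out k (ξ, v) = 0 := by
  obtain ⟨w, hw⟩ := hctrl.exists_state_eq_zero (S.state t (ξ, u))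
  let v : ℕ → U := fun k => if k < t then u k else if k < t + q then w (k - t) else 0
  have hvz : ∀ k, t + q ≤ k → v k = 0 := fun k hk => by
    simp only [v]; rw [if_neg (by omega), if_neg (by omega)]
  have hvu : ∀ k < t, v k = u k := fun k hk => by simp only [v]; rw [if_pos hk]
  refine ⟨v, hvu, hvz, fun k hk => ?_⟩
  obtain ⟨j, rfl⟩ := Nat.exists_eq_add_of_le hk
  rw [out_add, state_add, S.state_congr hvu]
  rw [S.state_congr (v := w), hw, out_eq_zero]
  · exact fun i _ => hvz _ (by omega)
  · intro i hi
    simp only [v]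
    rw [if_neg (by omega), if_pos (by omega), Nat.add_sub_cancel_left]

/-- If a functional of state and `K` inputs vanishes along a trajectory whose input is
persistently exciting of order `K + q`, it is zero. -/
lemma Controllable.functional_eq_zero {q K T : ℕ} [FiniteDimensional ℝ X]
    (hctrl : S.Controllable q) (hq : Module.finrank ℝ X = q) {x : ℕ → X} {u : ℕ → U}
    (hx : ∀ t, x (t + 1) = S.A (x t) + S.B (u t))
    (hpe : ∀ θ : Fin (K + q) → Module.Dual ℝ U,
      (∀ j, j + (K + q) ≤ T → ∑ k, θ k (u (j + k)) = 0) → θ = 0)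
    (ξ : Module.Dual ℝ X) (η : Fin K → Module.Dual ℝ U)
    (h : ∀ j, j + K ≤ T → ξ (x j) + ∑ i, η i (u (j + i)) = 0) : ξ = 0 ∧ η = 0 := by
  classical
  set c := S.A.charpoly.coeff with hc
  have hcq : c q = 1 := by
    have h1 := S.A.charpoly_monic.coeff_natDegree
    rwa [LinearMap.charpoly_natDegree, hq] at h1
  -- `ψ l` is the given functional evaluated at time l along an arbitrary trajectory.
  let ψ : ℕ → (X × (ℕ → U)) →ₗ[ℝ] ℝ := fun l => ξ ∘ₗ S.state l +
    ∑ i : Fin K, η i ∘ₗ LinearMap.proj (l + i) ∘ₗ LinearMap.snd ℝ X (ℕ → U)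
  have hψ : ∀ l z w, ψ l (z, w) = ξ (S.state l (z, w)) + ∑ i : Fin K, η i (w (l + i)) := by
    intro l z w
    simp [ψ, LinearMap.sum_apply]
  -- Weighted by the characteristic polynomial, the dependence on the initial state cancels by
  -- Cayley–Hamilton. What remains is a functional of K + q inputs that vanishes along the data,
  -- hence is zero by persistent excitation.
  let Θ : (X × (ℕ → U)) →ₗ[ℝ] ℝ := ∑ l ∈ Finset.range (q + 1), c l • ψ l
  have hΘ : ∀ z, Θ z = ∑ l ∈ Finset.range (q + 1), c l * ψ l z := by
    intro z
    simp [Θ, LinearMap.sum_apply]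
  have hΘx : ∀ z, Θ (z, 0) = 0 := by
    intro z
    have h1 : Polynomial.aeval S.A S.A.charpoly z = 0 := by
      rw [LinearMap.aeval_self_charpoly, LinearMap.zero_apply]
    rw [Polynomial.aeval_eq_sum_range, LinearMap.charpoly_natDegree, hq, LinearMap.sum_apply] at h1
    have h2 := congrArg ξ h1
    rw [map_sum, map_zero] at h2
    rw [hΘ, ← h2]
    refine Finset.sum_congr rfl fun l _ => ?_
    rw [hψ, S.state_zero_input _ _ (u := 0) fun _ _ => rfl]
    simp [hc]
  have hΘt : ∀ j, j + (K + q) ≤ T → Θ (x j, fun i => u (j + i)) = 0 := by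
    intro j hj
    rw [hΘ]
    refine Finset.sum_eq_zero fun l hl => ?_
    have hl := Finset.mem_range.1 hl
    have h1 := S.eq_state (x := fun i => x (j + i)) (u := fun i => u (j + i))
      (fun t => hx (j + t)) l
    have h2 := h (j + l) (by omega)
    simp only [add_zero] at h1
    simp only [add_assoc] at h2
    rw [hψ, ← h1, h2, mul_zero]
  have hΘcongr : ∀ v w : ℕ → U, (∀ k < K + q, v k = w k) → Θ (0, v) = Θ (0, w) := by
    intro v w hvw
    rw [hΘ, hΘ]
    refine Finset.sum_congr rfl fun l hl => ?_
    have hl := Finset.mem_range.1 hl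
    rw [hψ, hψ, S.state_congr fun k hk => hvw k (by omega)]
    congr 2
    exact Finset.sum_congr rfl fun i _ => by rw [hvw _ (by omega)]
  have hθ : ∀ k < K + q, ∀ v, Θ (0, Pi.single k v) = 0 := by
    let θ : Fin (K + q) → Module.Dual ℝ U := fun k =>
      Θ ∘ₗ LinearMap.inr ℝ X (ℕ → U) ∘ₗ LinearMap.single ℝ (fun _ => U) (k : ℕ)
    have h0 : θ = 0 := by
      refine hpe θ fun j hj => ?_
      have h1 := hΘt j hj
      have h2 : ((x j, fun i => u (j + i)) : X × (ℕ → U)) =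
        (x j, 0) + (0, fun i => u (j + i)) := by simp
      rw [h2, map_add, hΘx, zero_add,
        hΘcongr _ (∑ k : Fin (K + q), Pi.single (k : ℕ) (u (j + k)))] at h1
      · rw [← h1]
        have h3 : ((0, ∑ k : Fin (K + q), Pi.single (k : ℕ) (u (j + k))) : X × (ℕ → U)) =
            ∑ k : Fin (K + q), LinearMap.inr ℝ X (ℕ → U) (Pi.single (k : ℕ) (u (j + k))) := by
          rw [← map_sum]; rfl
        rw [h3, map_sum]
        rfl
      · intro k hk
        rw [Finset.sum_apply, Finset.sum_eq_single ⟨k, hk⟩]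
        · simp
        · intro b _ hb
          rw [Pi.single_eq_of_ne]
          exact fun h => hb (Fin.ext h.symm)
        · simp
    intro k hk v
    exact LinearMap.congr_fun (congrFun h0 ⟨k, hk⟩) v
  -- All coefficients in one sequence: first the action of ξ through the state, then η. The input at
  -- time k enters `ψ l` with coefficient `g (k + q - l)`.
  let g : ℕ → Module.Dual ℝ U := fun i =>
    if i < q then ξ ∘ₗ (S.A ^ (q - 1 - i)) ∘ₗ S.B
    else if h : i - q < K then η ⟨i - q, h⟩ else 0
  have hg : ∀ k, ∀ l ≤ q, ∀ v, ψ l (0, Pi.single k v) = g (k + q - l) v := by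
    intro k l hl v
    rw [hψ]
    by_cases hkl : k < l
    · have h1 : S.state l (0, Pi.single k v) = (S.A ^ (l - 1 - k)) (S.B v) := by
        have hq : l = k + 1 + (l - 1 - k) := by omega
        conv_lhs => rw [hq]
        rw [state_add, S.state_zero_input, state_succ, S.state_zero_input, map_zero, map_zero,
          zero_add]
        · simp
        · intro i hi
          rw [Pi.single_eq_of_ne (by omega)]
        · intro i _
          rw [Pi.single_eq_of_ne (by omega)]
      rw [h1, Finset.sum_eq_zero, add_zero]
      · simp only [g]
        rw [if_pos (by omega), show q - 1 - (k + q - l) = l - 1 - k by omega]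
        rfl
      · intro i _
        rw [Pi.single_eq_of_ne (by omega), map_zero]
    · have h1 : S.state l (0, Pi.single k v) = 0 := by
        rw [S.state_zero_input, map_zero]
        intro i hi
        rw [Pi.single_eq_of_ne (by omega)]
      rw [h1, map_zero, zero_add]
      simp only [g]
      rw [if_neg (by omega)]
      by_cases hK : k + q - l - q < K
      · rw [dif_pos hK, Finset.sum_eq_single ⟨k + q - l - q, hK⟩]
        · have h2 : l + (k + q - l - q) = k := by omega
          simp [h2]
        · intro b _ hb
          rw [Pi.single_eq_of_ne, map_zero]
          exact fun h => hb (Fin.ext (by simp only; omega))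
        · simp
      · rw [dif_neg hK]
        refine Finset.sum_eq_zero fun i _ => ?_
        rw [Pi.single_eq_of_ne (by omega), map_zero]
  -- Vanishing of Θ reads ∑ c_l g(k+q-l) = 0 with c_q = 1, so g(k) is a combination of g(k+1), …,
  -- g(k+q). As g vanishes from K + q on, backward recursion gives g = 0; d counts the steps back.
  have hg0 : ∀ d i, K + q ≤ i + d → g i = 0 := by
    intro d
    induction d with
    | zero =>
      intro i hi
      simp only [g]
      rw [if_neg (by omega), dif_neg (by omega)]
    | succ d ih =>
      intro i hi
      by_cases hi' : i < K + q
      · ext v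
        have h1 := hθ i hi' v
        rw [hΘ, Finset.sum_range_succ, Finset.sum_eq_zero, hcq, hg _ _ le_rfl, zero_add, one_mul,
          Nat.add_sub_cancel] at h1
        · exact h1
        · intro l hl
          have hl := Finset.mem_range.1 hl
          rw [hg _ _ hl.le, ih _ (by omega), LinearMap.zero_apply, mul_zero]
      · exact ih i (by omega)
  have hg1 : ∀ i, g i = 0 := fun i => hg0 (K + q) i (by omega)
  constructor
  · refine hctrl ξ fun i hi v => ?_
    have h1 := LinearMap.congr_fun (hg1 (q - 1 - i)) v
    simp only [g] at h1
    rw [if_pos (by omega), show q - 1 - (q - 1 - i) = i by omega] at h1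
    exact h1
  · funext i
    have h1 := hg1 (q + i)
    simp only [g] at h1
    rw [if_neg (by omega), dif_pos (by omega)] at h1
    simpa using h1

/-- States and input segments of length `K` along a trajectory with persistently exciting input
span all states and input segments. -/
lemma Controllable.exists_combination {q K T c : ℕ} [FiniteDimensional ℝ X]
    (hctrl : S.Controllable q) (hq : Module.finrank ℝ X = q) {x : ℕ → X} {u : ℕ → U}
    (hx : ∀ t, x (t + 1) = S.A (x t) + S.B (u t))
    (hpe : ∀ θ : Fin (K + q) → Module.Dual ℝ U,
      (∀ j, j + (K + q) ≤ T → ∑ k, θ k (u (j + k)) = 0) → θ = 0)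
    (hc : ∀ j, j + K ≤ T → j < c) (z : X) (v : ℕ → U) :
    ∃ α : Fin c → ℝ, ∑ j, α j • x j = z ∧ ∀ i < K, ∑ j, α j • u (j + i) = v i := by
  let f : Fin c → X × (Fin K → U) := fun j => (x j, fun i => u (j + i))
  have hspan : Submodule.span ℝ (Set.range f) = ⊤ := by
    by_contra hne
    obtain ⟨φ, hφ, hle⟩ := Submodule.exists_le_ker_of_lt_top _ (lt_top_iff_ne_top.2 hne)
    have hdec : ∀ a b, φ (a, b) = (φ ∘ₗ LinearMap.inl ℝ X (Fin K → U)) a +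
        ∑ i, (φ ∘ₗ LinearMap.inr ℝ X (Fin K → U) ∘ₗ LinearMap.single ℝ (fun _ => U) i) (b i) := by
      intro a b
      have h1 : ((a, b) : X × (Fin K → U)) = (a, 0) + (0, b) := by simp
      rw [h1, map_add]
      congr 1
      simp only [LinearMap.comp_apply]
      rw [← map_sum, ← map_sum]
      congr 2
      ext i
      simp
    obtain ⟨h1, h2⟩ := hctrl.functional_eq_zero hq hx hpe
      (φ ∘ₗ LinearMap.inl ℝ X (Fin K → U))
      (fun i => φ ∘ₗ LinearMap.inr ℝ X (Fin K → U) ∘ₗ LinearMap.single ℝ (fun _ => U) i)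
      (fun j hj => by
        rw [← hdec (x j) (fun i => u (j + i))]
        exact hle (Submodule.subset_span ⟨⟨j, hc j hj⟩, rfl⟩))
    refine hφ (LinearMap.ext fun ab => ?_)
    rw [show ab = (ab.1, ab.2) from rfl, hdec, h1]
    simp only [LinearMap.zero_apply, zero_add]
    exact Finset.sum_eq_zero fun i _ => LinearMap.congr_fun (congrFun h2 i) _
  obtain ⟨α, hα⟩ := (Submodule.mem_span_range_iff_exists_fun ℝ).1
    (hspan ▸ Submodule.mem_top (x := (z, fun i : Fin K => v i)))
  refine ⟨α, ?_, fun i hi => ?_⟩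
  · simpa [f, Prod.fst_sum] using congrArg Prod.fst hα
  · simpa [f, Prod.snd_sum, Finset.sum_apply] using congrFun (congrArg Prod.snd hα) ⟨i, hi⟩

end LookaheadSystem

/-! ### Hautus test and Fitting decomposition. -/

namespace Matrix

/-- A matrix of full column rank has trivial kernel. -/
lemma eq_zero_of_rank_eq_card {K ι κ : Type*} [Field K] [Fintype ι] [Fintype κ]
    {M : Matrix ι κ K} (h : M.rank = Fintype.card κ) {v : κ → K} (hv : M *ᵥ v = 0) : v = 0 := by
  have h1 := M.mulVecLin.finrank_range_add_finrank_ker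
  rw [Module.finrank_fintype_fun_eq_card] at h1
  have h2 : Module.finrank K (LinearMap.ker M.mulVecLin) = 0 := by
    have : M.rank = Module.finrank K (LinearMap.range M.mulVecLin) := rfl
    omega
  have h3 : v ∈ LinearMap.ker M.mulVecLin := hv
  rwa [Submodule.finrank_eq_zero.1 h2, Submodule.mem_bot] at h3

/-- The Hautus test: a real pair without complex unobservable modes is observable. -/
lemma hautus {q p : ℕ} (A : Matrix (Fin q) (Fin q) ℝ) (C : Matrix (Fin p) (Fin q) ℝ)
    (h : ∀ (μ : ℂ) (ζ : Fin q → ℂ), A.map (algebraMap ℝ ℂ) *ᵥ ζ = μ • ζ →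
      C.map (algebraMap ℝ ℂ) *ᵥ ζ = 0 → ζ = 0)
    {x : Fin q → ℝ} (hx : ∀ i < q, C *ᵥ (A ^ i *ᵥ x) = 0) : x = 0 := by
  -- Cayley–Hamilton extends the vanishing from i < q to all powers.
  have hall : ∀ i, C *ᵥ (A ^ i *ᵥ x) = 0 := by
    intro i
    induction i using Nat.strong_induction_on with
    | _ i ih =>
      by_cases hi : i < q
      · exact hx i hi
      · have h1 := A.aeval_self_charpoly
        have hd : A.charpoly.natDegree = q := by
          rw [charpoly_natDegree_eq_dim, Fintype.card_fin]
        have hm : A.charpoly.coeff q = 1 := by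
          have := A.charpoly_monic.coeff_natDegree
          rwa [hd] at this
        rw [Polynomial.aeval_eq_sum_range, hd, Finset.sum_range_succ, hm, one_smul] at h1
        have h2 := congrArg (fun M => C *ᵥ ((A ^ (i - q) * M) *ᵥ x)) h1
        simp only [mul_add, ← pow_add, Nat.sub_add_cancel (not_lt.1 hi), add_mulVec, mulVec_add,
          mul_zero, zero_mulVec, mulVec_zero, Finset.mul_sum, mul_smul_comm, sum_mulVec,
          mulVec_sum, smul_mulVec, mulVec_smul] at h2
        rwa [Finset.sum_eq_zero, zero_add] at h2
        intro l hl
        rw [ih _ (by have := Finset.mem_range.1 hl; omega), smul_zero]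
  by_contra hx0
  set φ := algebraMap ℝ ℂ with hφ
  -- The complex unobservable subspace is invariant and contains x. If x ≠ 0, it contains an
  -- eigenvector, which is an excluded unobservable mode.
  let W : Submodule ℂ (Fin q → ℂ) := ⨅ i : ℕ, LinearMap.ker ((C * A ^ i).map φ).mulVecLin
  have hW : ∀ z, z ∈ W ↔ ∀ i, (C * A ^ i).map φ *ᵥ z = 0 := by
    intro z
    simp [W, Submodule.mem_iInf]
  have hinv : ∀ z ∈ W, (A.map φ).mulVecLin z ∈ W := by
    intro z hz
    rw [hW] at hz ⊢
    intro i
    rw [mulVecLin_apply, mulVec_mulVec, ← Matrix.map_mul, Matrix.mul_assoc, ← pow_succ]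
    exact hz _
  have hne : Nontrivial W := by
    refine ⟨⟨⟨φ ∘ x, ?_⟩, 0, ?_⟩⟩
    · rw [hW]
      intro i
      have h3 := hall i
      rw [mulVec_mulVec] at h3
      funext j
      rw [← RingHom.map_mulVec, h3]
      simp
    · intro h0
      apply hx0
      have h4 := congrArg Subtype.val h0
      funext j
      have h5 := congrFun h4 j
      simpa [hφ] using h5
  obtain ⟨μ, hμ⟩ := Module.End.exists_eigenvalue ((A.map φ).mulVecLin.restrict hinv)
  obtain ⟨z, hz⟩ := hμ.exists_hasEigenvector
  apply hz.2
  have h6 := congrArg Subtype.val hz.apply_eq_smul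
  refine Subtype.ext (h μ z h6 ?_)
  have h7 := (hW z).1 z.2 0
  rwa [pow_zero, Matrix.mul_one] at h7

/-- The Fitting decomposition of a real matrix, in block form. -/
lemma exists_fitting {n : ℕ} (T : Matrix (Fin n) (Fin n) ℝ) :
    ∃ (q r : ℕ) (_ : Fin q ⊕ Fin r ≃ Fin n) (P : Matrix (Fin n) (Fin q ⊕ Fin r) ℝ)
      (P' : Matrix (Fin q ⊕ Fin r) (Fin n) ℝ) (F₁ : Matrix (Fin q) (Fin q) ℝ)
      (F₂ : Matrix (Fin r) (Fin r) ℝ), P' * P = 1 ∧ IsUnit F₁.det ∧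
      (∃ k ≥ 1, F₂ ^ k = 0) ∧ T * P = P * fromBlocks F₁ 0 0 F₂ := by
  let f := toLin' T
  -- Besides making the exponent of nilpotency positive, k ≥ 1 puts ker f inside ker f^k, whence f
  -- is injective on the range of f^k.
  obtain ⟨k, hcompl, hk1⟩ := (f.eventually_isCompl_ker_pow_range_pow.and
    (eventually_ge_atTop 1)).exists
  have hcompl := hcompl.symm
  set V := LinearMap.range (f ^ k)
  set W := LinearMap.ker (f ^ k)
  have hVinv : ∀ x ∈ V, f x ∈ V := by
    rintro _ ⟨y, rfl⟩
    exact ⟨f y, by rw [← Module.End.mul_apply, ← Module.End.mul_apply, (Commute.self_pow f k).eq]⟩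
  have hWinv : ∀ x ∈ W, f x ∈ W := by
    intro x hx
    rw [LinearMap.mem_ker] at hx ⊢
    rw [← Module.End.mul_apply, ← (Commute.self_pow f k).eq, Module.End.mul_apply, hx, map_zero]
  let g₁ : Module.End ℝ V := f.restrict hVinv
  let g₂ : Module.End ℝ W := f.restrict hWinv
  let bV := Module.finBasis ℝ V
  let bW := Module.finBasis ℝ W
  let b := (bV.prod bW).map (V.prodEquivOfIsCompl W hcompl)
  let e₀ := Pi.basisFun ℝ (Fin n)
  have hg₁ : IsUnit g₁ := by
    rw [LinearMap.isUnit_iff_ker_eq_bot, LinearMap.ker_eq_bot']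
    intro v hv
    have h1 : f (v : Fin n → ℝ) = 0 := congrArg Subtype.val hv
    have h2 : (v : Fin n → ℝ) ∈ W := by
      obtain ⟨l, rfl⟩ := Nat.exists_eq_add_of_le' hk1
      rw [LinearMap.mem_ker, pow_succ, Module.End.mul_apply, h1, map_zero]
    have h3 := Submodule.disjoint_def.1 hcompl.disjoint _ v.2 h2
    exact Subtype.ext h3
  have hg₂ : g₂ ^ k = 0 := by
    ext v : 1
    rw [Module.End.pow_restrict]
    exact Subtype.ext v.2
  have hcard : Fintype.card (Fin (Module.finrank ℝ V) ⊕ Fin (Module.finrank ℝ W)) =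
      Fintype.card (Fin n) := by
    rw [← Module.finrank_eq_card_basis b, Module.finrank_fintype_fun_eq_card]
  refine ⟨_, _, Fintype.equivOfCardEq hcard, e₀.toMatrix b, b.toMatrix e₀,
    LinearMap.toMatrix bV bV g₁, LinearMap.toMatrix bW bW g₂,
    b.toMatrix_mul_toMatrix_flip e₀, ?_, ⟨k, hk1, ?_⟩, ?_⟩
  · rw [LinearMap.det_toMatrix]
    exact hg₁.map LinearMap.det
  · rw [LinearMap.toMatrix_pow, hg₂, map_zero]
  · have h1 : LinearMap.toMatrix b b f = fromBlocks (LinearMap.toMatrix bV bV g₁) 0 0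
        (LinearMap.toMatrix bW bW g₂) := by
      have hl : ∀ j, f (b (Sum.inl j)) = (g₁ (bV j) : Fin n → ℝ) := fun j => by simp [b, g₁]
      have hr : ∀ j, f (b (Sum.inr j)) = (g₂ (bW j) : Fin n → ℝ) := fun j => by simp [b, g₂]
      ext (i | i) (j | j)
      · rw [LinearMap.toMatrix_apply, hl, fromBlocks_apply₁₁, LinearMap.toMatrix_apply]
        simp [b]
      · rw [LinearMap.toMatrix_apply, hr]
        simp [b]
      · rw [LinearMap.toMatrix_apply, hl]
        simp [b]
      · rw [LinearMap.toMatrix_apply, hr, fromBlocks_apply₂₂, LinearMap.toMatrix_apply]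
        simp [b]
    have h2 : LinearMap.toMatrix e₀ e₀ f = T := by
      rw [LinearMap.toMatrix_eq_toMatrix', LinearMap.toMatrix'_toLin']
    rw [← h1, basis_toMatrix_mul_linearMap_toMatrix, ← h2, linearMap_toMatrix_mul_basis_toMatrix]

end Matrix

/-! ### Existence of the quasi-Weierstraß form. -/

namespace DescriptorSystem

variable {n m p : ℕ} {sys : DescriptorSystem n m p}

/-- The determinant is a real polynomial in λ, nonzero because it has a nonzero complex value; such
a polynomial cannot vanish at every real point. -/
lemma IsRegular.exists_real (h : sys.IsRegular) : ∃ μ : ℝ, IsUnit (μ • sys.E - sys.A).det := by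
  obtain ⟨z, hz⟩ := h
  let P : Polynomial ℝ := Matrix.det
    ((Polynomial.X : Polynomial ℝ) • sys.E.map Polynomial.C - sys.A.map Polynomial.C)
  have hP : P ≠ 0 := by
    intro h0
    apply hz
    have h1 := congrArg (Polynomial.eval₂RingHom (algebraMap ℝ ℂ) z : Polynomial ℝ →+* ℂ) h0
    rw [map_zero, RingHom.map_det] at h1
    rw [← h1]
    congr 1
    ext i j
    simp [pencil, RingHom.mapMatrix_apply, mul_comm z]
  obtain ⟨μ, hμ⟩ : ∃ μ, P.eval μ ≠ 0 := by
    by_contra! hall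
    exact hP (Polynomial.funext fun x => by rw [hall, Polynomial.eval_zero])
  refine ⟨μ, isUnit_iff_ne_zero.2 fun h0 => hμ ?_⟩
  rw [← Polynomial.coe_evalRingHom, RingHom.map_det, ← h0]
  congr 1
  ext i j
  simp [RingHom.mapMatrix_apply, mul_comm μ]

open Matrix in
/-- A regular descriptor system has a quasi-Weierstrass form. -/
lemma IsRegular.exists_hasQuasiWeierstrassForm (h : sys.IsRegular) :
    ∃ q s, sys.HasQuasiWeierstrassForm q s := by
  obtain ⟨μ, hμ⟩ := h.exists_real
  -- With T = K⁻¹E one has K⁻¹A = μT - 1, so a Fitting basis of T block-diagonalizes both matrices.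
  -- The block H = μF₂ - 1 is invertible since F₂ is nilpotent.
  set K := μ • sys.E - sys.A with hK
  obtain ⟨q, r, e, P, P', F₁, F₂, hP, hF₁, ⟨k, hk1, hk⟩, hT⟩ := exists_fitting (K⁻¹ * sys.E)
  have hH : IsUnit (μ • F₂ - 1).det := by
    rw [← isUnit_iff_isUnit_det]
    have : IsNilpotent (μ • F₂) := ⟨k, by rw [smul_pow, hk, smul_zero]⟩
    rw [IsUnit.sub_iff]
    exact this.isUnit_one_sub
  set H := μ • F₂ - 1 with hHd
  have hcomm : Commute H⁻¹ F₂ := by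
    have h1 : Commute H F₂ := ((Commute.refl F₂).smul_left μ).sub_left (Commute.one_left F₂)
    unfold Commute SemiconjBy
    calc H⁻¹ * F₂ = H⁻¹ * (F₂ * H) * H⁻¹ := by
          rw [Matrix.mul_assoc, Matrix.mul_assoc, mul_nonsing_inv _ hH, Matrix.mul_one]
      _ = F₂ * H⁻¹ := by rw [← h1.eq, nonsing_inv_mul_cancel_left _ _ hH]
  have hex : ∃ l, 1 ≤ l ∧ (H⁻¹ * F₂) ^ l = 0 := ⟨k, hk1, by rw [hcomm.mul_pow, hk, mul_zero]⟩
  classical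
  -- Multiplying by F₁⁻¹ and H⁻¹ creates the identity blocks; H⁻¹F₂ stays nilpotent because H
  -- commutes with F₂.
  set D := fromBlocks F₁⁻¹ 0 0 H⁻¹ with hD
  have hE : sys.E * P = K * P * fromBlocks F₁ 0 0 F₂ := by
    rw [Matrix.mul_assoc, ← hT, Matrix.mul_assoc, mul_nonsing_inv_cancel_left _ _ hμ]
  have hA : sys.A * P = K * P * fromBlocks (μ • F₁ - 1) 0 0 H := by
    have h1 : sys.A = μ • sys.E - K := by rw [hK]; abel
    rw [h1, Matrix.sub_mul, smul_mul, hE]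
    have h2 : fromBlocks (μ • F₁ - 1) 0 0 H = μ • fromBlocks F₁ 0 0 F₂ - 1 := by
      ext (i | i) (j | j) <;> simp [hHd, Matrix.one_apply]
    rw [h2, Matrix.mul_sub, Matrix.mul_one, Matrix.mul_smul]
  have hSK : D * P' * K⁻¹ * (K * P) = D := by
    rw [Matrix.mul_assoc (D * P'), nonsing_inv_mul_cancel_left _ _ hμ, Matrix.mul_assoc, hP,
      Matrix.mul_one]
  refine ⟨q, Nat.find hex, r, e, (D * P' * K⁻¹).submatrix e.symm id, P.submatrix id e.symm,
    F₁⁻¹ * (μ • F₁ - 1), H⁻¹ * F₂, ?_, ?_, ?_, ?_, Nat.find_spec hex, fun l hl =>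
      Nat.find_min' hex hl⟩
  · have h1 : (D * P' * K⁻¹).submatrix e.symm id * (K * P).submatrix id e.symm =
        D.submatrix e.symm e.symm := by
      conv_rhs => rw [← hSK]
      exact (submatrix_mul _ _ _ _ _ Function.bijective_id).symm
    have h2 := congrArg det h1
    rw [det_mul, det_submatrix_equiv_self, hD, det_fromBlocks_zero₂₁] at h2
    refine isUnit_of_mul_isUnit_left (y := ((K * P).submatrix id e.symm).det) ?_
    rw [hD, h2]
    exact (isUnit_nonsing_inv_det _ hF₁).mul (isUnit_nonsing_inv_det _ hH)
  · refine isUnit_det_of_left_inverse (B := P'.submatrix e.symm id) ?_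
    rw [← submatrix_mul _ _ _ _ _ Function.bijective_id, hP, submatrix_one_equiv]
  · have h1 : D * P' * K⁻¹ * sys.E * P = fromBlocks 1 0 0 (H⁻¹ * F₂) := by
      rw [Matrix.mul_assoc, hE, ← Matrix.mul_assoc, hSK, hD, fromBlocks_multiply]
      simp [nonsing_inv_mul _ hF₁]
    rw [reindex_apply, ← h1]
    rfl
  · have h1 : D * P' * K⁻¹ * sys.A * P = fromBlocks (F₁⁻¹ * (μ • F₁ - 1)) 0 0 1 := by
      rw [Matrix.mul_assoc, hA, ← Matrix.mul_assoc, hSK, hD, fromBlocks_multiply]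
      simp [nonsing_inv_mul _ hH]
    rw [reindex_apply, ← h1]
    rfl

/-- Infima of nonempty sets of naturals are attained, so one form realizes both `q` and `s`; its
uniqueness plays no role. -/
lemma IsRegular.hasQuasiWeierstrassForm (h : sys.IsRegular) :
    sys.HasQuasiWeierstrassForm sys.q sys.s :=
  Nat.sInf_mem (s := {s | sys.HasQuasiWeierstrassForm sys.q s})
    (Nat.sInf_mem (s := {q | ∃ s, sys.HasQuasiWeierstrassForm q s})
      h.exists_hasQuasiWeierstrassForm)

end DescriptorSystem

/-! ### From the rank conditions on the pencil to the slow subsystem. -/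

namespace Matrix

/-- Splitting of the coordinates along `e : Fin q ⊕ Fin r ≃ Fin n`. -/
def splitEquiv (K : Type*) [Semiring K] {q r n : ℕ} (e : Fin q ⊕ Fin r ≃ Fin n) :
    (Fin n → K) ≃ₗ[K] (Fin q → K) × (Fin r → K) :=
  (LinearEquiv.funCongrLeft K K e).trans (LinearEquiv.sumArrowLequivProdArrow (Fin q) (Fin r) K K)

variable {K : Type*} [CommRing K] {q r n : ℕ} (e : Fin q ⊕ Fin r ≃ Fin n)

lemma splitEquiv_symm_comp (z : (Fin q → K) × (Fin r → K)) :
    (splitEquiv K e).symm z ∘ e = Sum.elim z.1 z.2 := by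
  obtain ⟨a, b⟩ := z
  ext (i | i) <;> simp [splitEquiv, LinearEquiv.funCongrLeft, LinearMap.funLeft]

lemma splitEquiv_reindex_mulVec (a : Matrix (Fin q) (Fin q) K) (d : Matrix (Fin r) (Fin r) K)
    (x : Fin n → K) :
    splitEquiv K e (reindex e e (fromBlocks a 0 0 d) *ᵥ x) =
      (a *ᵥ (splitEquiv K e x).1, d *ᵥ (splitEquiv K e x).2) := by
  obtain ⟨z, rfl⟩ := (splitEquiv K e).symm.surjective x
  rw [LinearEquiv.apply_symm_apply, reindex_apply, submatrix_mulVec_equiv]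
  simp only [Equiv.symm_symm, splitEquiv_symm_comp, fromBlocks_mulVec]
  apply (splitEquiv K e).symm.injective
  rw [LinearEquiv.symm_apply_apply]
  apply e.surjective.injective_comp_right
  simp only
  rw [splitEquiv_symm_comp]
  ext (i | i) <;> simp

lemma submatrix_inl_mulVec {p : ℕ} (C : Matrix (Fin p) (Fin n) K) (z : Fin q → K) :
    C *ᵥ (splitEquiv K e).symm (z, 0) = C.submatrix id (e ∘ Sum.inl) *ᵥ z := by
  ext i
  simp only [mulVec, dotProduct]
  rw [← e.sum_comp, Fintype.sum_sum_type]
  have h := splitEquiv_symm_comp e (z, (0 : Fin r → K))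
  have h1 : ∀ j, (splitEquiv K e).symm (z, 0) (e (Sum.inl j)) = z j := fun j =>
    congrFun h (Sum.inl j)
  have h2 : ∀ j, (splitEquiv K e).symm (z, 0) (e (Sum.inr j)) = 0 := fun j =>
    congrFun h (Sum.inr j)
  simp [h1, h2]

/-- The slow subsystem of an R-observable pencil is observable. -/
lemma observable_of_pencil {p : ℕ} {E A S P : Matrix (Fin n) (Fin n) ℝ}
    {C : Matrix (Fin p) (Fin n) ℝ} {A₁ : Matrix (Fin q) (Fin q) ℝ} {N : Matrix (Fin r) (Fin r) ℝ}
    (hS : IsUnit S.det) (hP : IsUnit P.det)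
    (hE : S * E * P = reindex e e (fromBlocks 1 0 0 N))
    (hA : S * A * P = reindex e e (fromBlocks A₁ 0 0 1))
    (hobs : ∀ μ : ℂ, (fromRows (μ • E.map (algebraMap ℝ ℂ) - A.map (algebraMap ℝ ℂ))
      (C.map (algebraMap ℝ ℂ))).rank = n)
    {x : Fin q → ℝ}
    (hx : ∀ i < q, (C * P).submatrix id (e ∘ Sum.inl) *ᵥ (A₁ ^ i *ᵥ x) = 0) : x = 0 := by
  set φ := algebraMap ℝ ℂ with hφ
  refine hautus A₁ _ (fun μ ζ hζ hC => ?_) hx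
  have hunit : ∀ M : Matrix (Fin n) (Fin n) ℝ, IsUnit M.det →
      Function.Injective (M.map φ).mulVec := by
    intro M hM
    rw [mulVec_injective_iff_isUnit, isUnit_iff_isUnit_det]
    have := hM.map φ
    rwa [RingHom.map_det] at this
  -- Pad an unobservable mode by zero: S E P fixes w and S A P multiplies it by μ. Hence P w lies in
  -- the kernel of both μE - A and C, and the rank condition forces it to vanish.
  set w := (splitEquiv ℂ e).symm (ζ, 0) with hw
  have hEw : S.map φ *ᵥ (E.map φ *ᵥ (P.map φ *ᵥ w)) = w := by
    have h1 := congrArg (fun M : Matrix (Fin n) (Fin n) ℝ => M.map φ *ᵥ w) hE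
    simp only [Matrix.map_mul, ← mulVec_mulVec] at h1
    rw [h1]
    apply (splitEquiv ℂ e).injective
    have h2 : (reindex e e (fromBlocks 1 0 0 N)).map φ =
        reindex e e (fromBlocks (1 : Matrix (Fin q) (Fin q) ℂ) 0 0 (N.map φ)) := by
      rw [reindex_apply, reindex_apply, ← submatrix_map, fromBlocks_map]
      simp
    rw [h2, splitEquiv_reindex_mulVec, hw, LinearEquiv.apply_symm_apply]
    simp
  have hAw : S.map φ *ᵥ (A.map φ *ᵥ (P.map φ *ᵥ w)) = μ • w := by
    have h1 := congrArg (fun M : Matrix (Fin n) (Fin n) ℝ => M.map φ *ᵥ w) hA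
    simp only [Matrix.map_mul, ← mulVec_mulVec] at h1
    rw [h1]
    apply (splitEquiv ℂ e).injective
    have h2 : (reindex e e (fromBlocks A₁ 0 0 1)).map φ =
        reindex e e (fromBlocks (A₁.map φ) 0 0 (1 : Matrix (Fin r) (Fin r) ℂ)) := by
      rw [reindex_apply, reindex_apply, ← submatrix_map, fromBlocks_map]
      simp
    rw [h2, splitEquiv_reindex_mulVec, map_smul, hw, LinearEquiv.apply_symm_apply, hζ]
    simp
  have h3 : P.map φ *ᵥ w = 0 := by
    refine eq_zero_of_rank_eq_card ((hobs μ).trans (Fintype.card_fin n).symm) ?_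
    rw [fromRows_mulVec]
    have h4 : (μ • E.map φ - A.map φ) *ᵥ (P.map φ *ᵥ w) = 0 := by
      apply hunit S hS
      rw [sub_mulVec, mulVec_sub, smul_mulVec, mulVec_smul, hEw, hAw, sub_self, mulVec_zero]
    have h5 : C.map φ *ᵥ (P.map φ *ᵥ w) = 0 := by
      rw [mulVec_mulVec, ← Matrix.map_mul, hw, submatrix_inl_mulVec, submatrix_map]
      exact hC
    rw [h4, h5]
    ext (i | i) <;> rfl
  have h6 : w = 0 := hunit P hP (by rw [h3, mulVec_zero])
  rw [hw, LinearEquiv.map_eq_zero_iff] at h6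
  exact congrArg Prod.fst h6

end Matrix

/-! ### Slow and fast coordinates. -/

namespace DescriptorSystem

variable {n m p : ℕ} (sys : DescriptorSystem n m p)

/-- Coordinates `Φ x = (x₁, x₂)` of the state and `Ψ` of the equations in which the system splits
into `x₁(t+1) = A₁ x₁(t) + B₁ u(t)` and `N x₂(t+1) = x₂(t) + B₂ u(t)` with `N ^ s = 0`. -/
structure Coordinates (q s : ℕ) where
  r : ℕ
  Φ : (Fin n → ℝ) ≃ₗ[ℝ] (Fin q → ℝ) × (Fin r → ℝ)
  Ψ : (Fin n → ℝ) ≃ₗ[ℝ] (Fin q → ℝ) × (Fin r → ℝ)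
  A₁ : (Fin q → ℝ) →ₗ[ℝ] (Fin q → ℝ)
  N : (Fin r → ℝ) →ₗ[ℝ] (Fin r → ℝ)
  map_E : ∀ x, Ψ (sys.E.mulVec x) = ((Φ x).1, N (Φ x).2)
  map_A : ∀ x, Ψ (sys.A.mulVec x) = (A₁ (Φ x).1, (Φ x).2)
  N_pow : N ^ s = 0
  one_le : 1 ≤ s

namespace Coordinates

variable {sys} {q s : ℕ} (W : sys.Coordinates q s)

/-- The input matrix of the fast subsystem. -/
def B₂ : (Fin m → ℝ) →ₗ[ℝ] (Fin W.r → ℝ) :=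
  LinearMap.snd ℝ _ _ ∘ₗ W.Ψ.toLinearMap ∘ₗ sys.B.mulVecLin

/-- The output matrix of the fast subsystem. -/
def C₂ : (Fin W.r → ℝ) →ₗ[ℝ] (Fin p → ℝ) :=
  sys.C.mulVecLin ∘ₗ W.Φ.symm.toLinearMap ∘ₗ LinearMap.inr ℝ _ _

/-- The slow subsystem, with the output of the fast subsystem as feedthrough. -/
def slow : LookaheadSystem (Fin q → ℝ) (Fin m → ℝ) (Fin p → ℝ) where
  A := W.A₁
  B := LinearMap.fst ℝ _ _ ∘ₗ W.Ψ.toLinearMap ∘ₗ sys.B.mulVecLin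
  C := sys.C.mulVecLin ∘ₗ W.Φ.symm.toLinearMap ∘ₗ LinearMap.inl ℝ _ _
  G i := (if i = 0 then sys.D.mulVecLin else 0) - W.C₂ ∘ₗ (W.N ^ i) ∘ₗ W.B₂
  s := s

end Coordinates

open Matrix in
/-- Coordinates of a regular, R-controllable and R-observable system. -/
lemma HasQuasiWeierstrassForm.exists_coordinates {q s : ℕ} (h : sys.HasQuasiWeierstrassForm q s)
    (hctrl : sys.IsRControllable) (hobs : sys.IsRObservable) :
    ∃ W : sys.Coordinates q s, W.slow.Controllable q ∧ W.slow.Observable q := by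
  obtain ⟨r, e, S, P, A₁, N, hS, hP, hE, hA, ⟨hs, hN⟩, -⟩ := h
  let ΨS : (Fin n → ℝ) ≃ₗ[ℝ] (Fin n → ℝ) := S.toLinearEquiv' (S.invertibleOfIsUnitDet hS)
  let ΦP : (Fin n → ℝ) ≃ₗ[ℝ] (Fin n → ℝ) := P.toLinearEquiv' (P.invertibleOfIsUnitDet hP)
  have hΦP : ∀ x, P *ᵥ (ΦP.symm x) = x := fun x => ΦP.apply_symm_apply x
  have key : ∀ M : Matrix (Fin n) (Fin n) ℝ, ∀ x,
      S *ᵥ (M *ᵥ x) = (S * M * P) *ᵥ (ΦP.symm x) := by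
    intro M x
    conv_lhs => rw [← hΦP x]
    simp [mulVec_mulVec, Matrix.mul_assoc]
  let W : sys.Coordinates q s :=
    { r := r
      Φ := ΦP.symm.trans (splitEquiv ℝ e)
      Ψ := ΨS.trans (splitEquiv ℝ e)
      A₁ := A₁.mulVecLin
      N := N.mulVecLin
      map_E := fun x => by
        change splitEquiv ℝ e (S *ᵥ (sys.E *ᵥ x)) = _
        rw [key, hE, splitEquiv_reindex_mulVec, one_mulVec]
        rfl
      map_A := fun x => by
        change splitEquiv ℝ e (S *ᵥ (sys.A *ᵥ x)) = _
        rw [key, hA, splitEquiv_reindex_mulVec, one_mulVec]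
        rfl
      N_pow := by
        rw [← toLin'_apply', ← toLin'_pow, hN, map_zero]
      one_le := hs }
  have hApow : ∀ i x, (W.slow.A ^ i) x = A₁ ^ i *ᵥ x := by
    intro i x
    have : W.slow.A = toLin' A₁ := rfl
    rw [this, ← toLin'_pow, toLin'_apply]
  refine ⟨W, ?_, ?_⟩
  · intro φ hφ
    obtain ⟨x, rfl⟩ : ∃ x : Fin q → ℝ, φ = dotProductBilin ℝ ℝ x := by
      refine ⟨fun i => φ (Pi.single i 1), LinearMap.pi_ext' fun i => ?_⟩
      ext
      simp
    have hx : x = 0 := by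
      -- Controllability is observability of the transposed pencil, whose form has Pᵀ and Sᵀ in the
      -- roles of S and P.
      have hE' : Pᵀ * sys.Eᵀ * Sᵀ = reindex e e (fromBlocks 1 0 0 Nᵀ) := by
        have := congrArg transpose hE
        simpa [Matrix.mul_assoc, fromBlocks_transpose] using this
      have hA' : Pᵀ * sys.Aᵀ * Sᵀ = reindex e e (fromBlocks A₁ᵀ 0 0 1) := by
        have := congrArg transpose hA
        simpa [Matrix.mul_assoc, fromBlocks_transpose] using this
      refine observable_of_pencil e (C := sys.Bᵀ) (by rwa [det_transpose]) (by rwa [det_transpose])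
        hE' hA' (fun μ => ?_) fun i hi => ?_
      · refine Eq.trans ?_ (hctrl μ)
        rw [← rank_transpose, transpose_fromRows]
        rfl
      · have h1 := hφ i hi
        have h2 : ∀ v, W.slow.B v = ((sys.Bᵀ * Sᵀ).submatrix id (e ∘ Sum.inl))ᵀ *ᵥ v := by
          intro v
          rw [← transpose_mul]
          change (splitEquiv ℝ e (S *ᵥ (sys.B *ᵥ v))).1 = _
          rw [mulVec_mulVec]
          rfl
        simp only [hApow, h2, dotProductBilin_apply_apply] at h1
        rw [← transpose_pow, ← vecMul_transpose, ← vecMul_transpose, transpose_transpose]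
        refine dotProduct_eq_zero _ fun v => ?_
        rw [← dotProduct_mulVec, ← dotProduct_mulVec]
        exact h1 v
    rw [hx, map_zero]
  · intro x hx
    refine observable_of_pencil e hS hP hE hA hobs fun i hi => ?_
    rw [← hApow, ← submatrix_inl_mulVec, ← mulVec_mulVec]
    exact hx i hi

end DescriptorSystem

/-! ### Trajectories in coordinates: null control, gluing, completeness. -/

namespace DescriptorSystem

variable {n m p : ℕ} {sys : DescriptorSystem n m p}

namespace Coordinates

variable {q s : ℕ} (W : sys.Coordinates q s)

/-- The state of the fast subsystem. -/
def fast (u : ℕ → Fin m → ℝ) (t : ℕ) : Fin W.r → ℝ :=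
  -∑ i ∈ Finset.range s, (W.N ^ i) (W.B₂ (u (t + i)))

/-- The state trajectory with initial slow state `ξ` and input `u`. -/
def traj (ξ : Fin q → ℝ) (u : ℕ → Fin m → ℝ) (t : ℕ) : Fin n → ℝ :=
  W.Φ.symm (W.slow.state t (ξ, u), W.fast u t)

lemma map_B (v : Fin m → ℝ) : W.Ψ (sys.B.mulVec v) = (W.slow.B v, W.B₂ v) := rfl

/-- Since N^s = 0 the last summand drops out. Thus E x(t) involves only the inputs u(t), …,
u(t+s-2), one fewer than x(t); this is what null control exploits. -/
lemma N_fast (u : ℕ → Fin m → ℝ) (t : ℕ) :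
    W.N (W.fast u t) = -∑ i ∈ Finset.range (s - 1), (W.N ^ (i + 1)) (W.B₂ (u (t + i))) := by
  have hs : s = s - 1 + 1 := (Nat.sub_add_cancel W.one_le).symm
  have h1 : ∀ z, (W.N ^ (s - 1 + 1)) z = 0 := by
    intro z
    rw [← hs, W.N_pow, LinearMap.zero_apply]
  have h2 : ∀ f : ℕ → Fin W.r → ℝ,
      ∑ i ∈ Finset.range s, f i = ∑ i ∈ Finset.range (s - 1), f i + f (s - 1) := by
    intro f
    rw [← Finset.sum_range_succ, ← hs]
  rw [fast, map_neg, map_sum, h2]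
  simp only [← Module.End.mul_apply, ← pow_succ']
  rw [h1, add_zero]

lemma fast_succ (u : ℕ → Fin m → ℝ) (t : ℕ) :
    W.N (W.fast u (t + 1)) = W.fast u t + W.B₂ (u t) := by
  have hs : s = s - 1 + 1 := (Nat.sub_add_cancel W.one_le).symm
  have h1 : W.fast u t = -∑ i ∈ Finset.range (s - 1 + 1), (W.N ^ i) (W.B₂ (u (t + i))) := by
    rw [← hs]; rfl
  rw [N_fast, h1, Finset.sum_range_succ']
  simp [add_assoc, add_comm 1]

lemma out_eq (ξ : Fin q → ℝ) (u : ℕ → Fin m → ℝ) (t : ℕ) :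
    W.slow.out t (ξ, u) = sys.C.mulVec (W.traj ξ u t) + sys.D.mulVec (u t) := by
  have h1 : W.traj ξ u t = W.Φ.symm (W.slow.state t (ξ, u), 0) + W.Φ.symm (0, W.fast u t) := by
    rw [traj, ← map_add, Prod.mk_add_mk, add_zero, zero_add]
  have h2 : ∀ z, sys.C.mulVec (W.Φ.symm (0, z)) = W.C₂ z := fun z => rfl
  have h3 : ∀ z, sys.C.mulVec (W.Φ.symm (z, 0)) = W.slow.C z := fun z => rfl
  have h4 : ∑ i ∈ Finset.range s, (if i = 0 then sys.D.mulVecLin else 0) (u (t + i)) =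
      sys.D.mulVec (u t) := by
    rw [Finset.sum_eq_single 0]
    · simp
    · intro i _ hi
      simp [hi]
    · intro h0
      exact absurd (Finset.mem_range.2 W.one_le) h0
  have h5 : ∑ i ∈ Finset.range W.slow.s, W.slow.G i (u (t + i)) =
      sys.D.mulVec (u t) + W.C₂ (W.fast u t) := by
    rw [← h4, fast, map_neg, map_sum, ← sub_eq_add_neg, ← Finset.sum_sub_distrib]
    rfl
  rw [LookaheadSystem.out_apply, h5, h1, Matrix.mulVec_add, h2, h3]
  abel

lemma traj_mem (ξ : Fin q → ℝ) (u : ℕ → Fin m → ℝ) :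
    (W.traj ξ u, u, fun t => W.slow.out t (ξ, u)) ∈ sys.fullBehavior := by
  refine fun t => ⟨W.Ψ.injective ?_, W.out_eq ξ u t⟩
  rw [map_add, W.map_E, W.map_A, W.map_B]
  simp only [traj, LinearEquiv.apply_symm_apply, fast_succ, LookaheadSystem.state_succ]
  rfl

/-- Iterating the fast equation k times expresses x₂(t) by x₂(t+k) and k inputs; at k = s the future
state disappears. The fast part therefore has no free initial value. -/
lemma eq_traj {x : ℕ → Fin n → ℝ} {u : ℕ → Fin m → ℝ} {y : ℕ → Fin p → ℝ}
    (h : (x, u, y) ∈ sys.fullBehavior) (t : ℕ) : x t = W.traj (W.Φ (x 0)).1 u t := by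
  have h1 : ∀ t, ((W.Φ (x (t + 1))).1, W.N (W.Φ (x (t + 1))).2) =
      (W.slow.A (W.Φ (x t)).1 + W.slow.B (u t), (W.Φ (x t)).2 + W.B₂ (u t)) := by
    intro t
    have h2 := congrArg W.Ψ (h t).1
    rwa [map_add, W.map_E, W.map_A, W.map_B] at h2
  have h2 : ∀ k t, (W.Φ (x t)).2 =
      (W.N ^ k) (W.Φ (x (t + k))).2 - ∑ i ∈ Finset.range k, (W.N ^ i) (W.B₂ (u (t + i))) := by
    intro k t
    induction k with
    | zero => simp
    | succ k ih =>
      have h3 := congrArg Prod.snd (h1 (t + k))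
      rw [ih, eq_sub_of_add_eq h3.symm, map_sub, Finset.sum_range_succ, pow_succ,
        Module.End.mul_apply, add_assoc]
      abel
  rw [traj, LinearEquiv.eq_symm_apply]
  refine Prod.ext ?_ ?_
  · exact W.slow.eq_state (x := fun t => (W.Φ (x t)).1) (fun t => congrArg Prod.fst (h1 t)) t
  · rw [h2 s t, W.N_pow, LinearMap.zero_apply, zero_sub]
    rfl

/-- The input determines the fast state, so input-output trajectories are parametrized by the slow
initial state and an arbitrary input. -/
lemma mem_manifest_iff {u : ℕ → Fin m → ℝ} {y : ℕ → Fin p → ℝ} :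
    (u, y) ∈ sys.manifestBehavior ↔ ∃ ξ, ∀ t, y t = W.slow.out t (ξ, u) := by
  constructor
  · rintro ⟨x, hx⟩
    refine ⟨(W.Φ (x 0)).1, fun t => ?_⟩
    rw [W.out_eq, ← W.eq_traj hx]
    exact (hx t).2
  · rintro ⟨ξ, hξ⟩
    obtain rfl : y = fun t => W.slow.out t (ξ, u) := funext hξ
    exact ⟨_, W.traj_mem ξ u⟩

/-- Every trajectory can be replaced by one with the same initial value `E x(0)` whose input and
output vanish after `q + s - 1` time steps. -/
lemma exists_null_control (hctrl : W.slow.Controllable q) {x : ℕ → Fin n → ℝ}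
    {u : ℕ → Fin m → ℝ} {y : ℕ → Fin p → ℝ} (h : (x, u, y) ∈ sys.fullBehavior) :
    ∃ x' u' y', (x', u', y') ∈ sys.fullBehavior ∧ sys.E.mulVec (x' 0) = sys.E.mulVec (x 0) ∧
      ∀ k, q + s - 1 ≤ k → u' k = 0 ∧ y' k = 0 := by
  have hs := W.one_le
  -- The first s - 1 inputs are kept because they enter E x(0); the next q steer the slow state to
  -- zero.
  obtain ⟨v, hv, hv0, hy0⟩ := hctrl.exists_input (W.Φ (x 0)).1 u (s - 1)
  refine ⟨_, _, _, W.traj_mem (W.Φ (x 0)).1 v, W.Ψ.injective ?_, fun k hk =>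
    ⟨hv0 k (by omega), hy0 k (by omega)⟩⟩
  rw [W.eq_traj h 0, W.map_E, W.map_E]
  simp only [traj, LinearEquiv.apply_symm_apply, LookaheadSystem.state_zero, N_fast]
  congr 2
  refine Finset.sum_congr rfl fun i hi => ?_
  rw [zero_add, hv i (Finset.mem_range.1 hi)]

/-- A trajectory whose input and output vanish at the times `0, …, q + s - 1` has initial
state zero. -/
lemma state_eq_zero (hobs : W.slow.Observable q) {x : ℕ → Fin n → ℝ}
    {u : ℕ → Fin m → ℝ} {y : ℕ → Fin p → ℝ} (h : (x, u, y) ∈ sys.fullBehavior)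
    (h0 : ∀ k < q + s, u k = 0 ∧ y k = 0) : x 0 = 0 := by
  have hs := W.one_le
  have hy : ∀ t, y t = W.slow.out t ((W.Φ (x 0)).1, u) := by
    intro t
    rw [W.out_eq, ← W.eq_traj h]
    exact (h t).2
  have hW : W.slow.s = s := rfl
  have h1 : (W.Φ (x 0)).1 = 0 := hobs.eq_zero (fun k hk => (h0 k (by omega)).1)
    (fun k hk => by rw [← hy, (h0 k (by omega)).2]) hs
  -- The fast state reads s inputs. For q = 0 this is one more than q + s - 1, which explains the
  -- length q + s.
  have h2 : W.fast u 0 = 0 := by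
    rw [fast, Finset.sum_eq_zero, neg_zero]
    intro i hi
    rw [(h0 _ (by have := Finset.mem_range.1 hi; omega)).1, map_zero, map_zero]
  rw [W.eq_traj h 0, h1, traj, h2, LookaheadSystem.state_zero, Prod.mk_zero_zero, map_zero]

/-- Two input-output trajectories that agree for `q + s - 1` time steps can be concatenated. -/
lemma exists_concat (hobs : W.slow.Observable q) {u u' : ℕ → Fin m → ℝ} {y y' : ℕ → Fin p → ℝ}
    (h : (u, y) ∈ sys.manifestBehavior) (h' : (u', y') ∈ sys.manifestBehavior) {t : ℕ}
    (heq : ∀ k < q + s - 1, u (t + k) = u' k ∧ y (t + k) = y' k) :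
    ∃ v z, (v, z) ∈ sys.manifestBehavior ∧ (∀ k < t + (q + s - 1), v k = u k ∧ z k = y k) ∧
      ∀ k, v (t + k) = u' k ∧ z (t + k) = y' k := by
  have hs := W.one_le
  have hW : W.slow.s = s := rfl
  obtain ⟨ξ, hξ⟩ := W.mem_manifest_iff.1 h
  obtain ⟨ζ, hζ⟩ := W.mem_manifest_iff.1 h'
  -- The overlap identifies the slow states at time t, so switching the input there continues the
  -- first trajectory by the second.
  have hst : W.slow.state t (ξ, u) = ζ := by
    refine hobs.state_unique (u := fun k => u (t + k)) (v := u') (fun k hk => (heq k hk).1)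
      (fun k hk => ?_) hs
    rw [← LookaheadSystem.out_add, ← hξ, ← hζ]
    exact (heq k hk).2
  let v : ℕ → Fin m → ℝ := fun k => if k < t then u k else u' (k - t)
  have hv' : ∀ k, v (t + k) = u' k := by
    intro k
    simp [v]
  have hv : ∀ k < t + (q + s - 1), v k = u k := by
    intro k hk
    by_cases hkt : k < t
    · simp [v, hkt]
    · obtain ⟨j, rfl⟩ := Nat.exists_eq_add_of_le (not_lt.1 hkt)
      rw [hv', (heq j (by omega)).1]
  have hout : ∀ k, W.slow.out (t + k) (ξ, v) = y' k := by
    intro k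
    rw [LookaheadSystem.out_add, W.slow.state_congr (v := u) fun i hi => hv i (by omega), hst, hζ]
    congr
    exact funext hv'
  refine ⟨v, fun k => W.slow.out k (ξ, v), W.mem_manifest_iff.2 ⟨ξ, fun _ => rfl⟩,
    fun k hk => ⟨hv k hk, ?_⟩, fun k => ⟨hv' k, hout k⟩⟩
  by_cases hkt : k < t
  · simp only
    rw [hξ]
    exact W.slow.out_congr (fun i hi => hv i (by omega)) ξ
  · obtain ⟨j, rfl⟩ := Nat.exists_eq_add_of_le (not_lt.1 hkt)
    simp only
    rw [hout, (heq j (by omega)).2]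

/-- The output is determined by the first `q + s - 1` samples and the input. -/
lemma output_unique (hobs : W.slow.Observable q) {u u' : ℕ → Fin m → ℝ} {y y' : ℕ → Fin p → ℝ}
    (h : (u, y) ∈ sys.manifestBehavior) (h' : (u', y') ∈ sys.manifestBehavior) {k : ℕ}
    (hu : ∀ i < k + s, u i = u' i) (huw : ∀ i < q + s - 1, u i = u' i)
    (hyw : ∀ i < q + s - 1, y i = y' i) : y k = y' k := by
  obtain ⟨ξ, hξ⟩ := W.mem_manifest_iff.1 h
  obtain ⟨ζ, hζ⟩ := W.mem_manifest_iff.1 h'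
  have hst : ξ = ζ := hobs.state_unique huw
    (fun i hi => by rw [← hξ, ← hζ]; exact hyw i hi) W.one_le
  rw [hξ, hζ, hst]
  exact W.slow.out_congr hu ζ

/-- The manifest behavior is complete: it is determined by its finite restrictions. -/
lemma mem_manifest_of_forall (hobs : W.slow.Observable q) {u : ℕ → Fin m → ℝ}
    {y : ℕ → Fin p → ℝ}
    (h : ∀ K, ∃ v z, (v, z) ∈ sys.manifestBehavior ∧ ∀ k < K, v k = u k ∧ z k = y k) :
    (u, y) ∈ sys.manifestBehavior := by
  -- The extra s samples cover the look-ahead of the outputs in the window that determines ξ.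
  obtain ⟨v, z, hvz, hK⟩ := h (q + s + s)
  obtain ⟨ξ, hξ⟩ := W.mem_manifest_iff.1 hvz
  refine W.mem_manifest_iff.2 ⟨ξ, fun t => ?_⟩
  obtain ⟨v', z', hvz', hK'⟩ := h (t + q + s)
  rw [← (hK' t (by have := W.one_le; omega)).2]
  refine W.output_unique hobs hvz' (W.mem_manifest_iff.2 ⟨ξ, fun _ => rfl⟩)
    (fun i hi => (hK' i (by omega)).1) (fun i hi => (hK' i (by omega)).1) fun i hi => ?_
  have hv : ∀ k < i + W.slow.s, v k = u k := fun k hk =>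
    (hK k (by have : W.slow.s = s := rfl; omega)).1
  rw [(hK' i (by omega)).2, ← (hK i (by omega)).2, hξ]
  exact W.slow.out_congr hv ξ

end Coordinates

lemma shift_mem_fullBehavior {x : ℕ → Fin n → ℝ} {u : ℕ → Fin m → ℝ} {y : ℕ → Fin p → ℝ}
    (h : (x, u, y) ∈ sys.fullBehavior) (t : ℕ) :
    (fun k => x (t + k), fun k => u (t + k), fun k => y (t + k)) ∈ sys.fullBehavior :=
  fun k => h (t + k)

lemma shift_mem_manifestBehavior {u : ℕ → Fin m → ℝ} {y : ℕ → Fin p → ℝ}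
    (h : (u, y) ∈ sys.manifestBehavior) (t : ℕ) :
    (fun k => u (t + k), fun k => y (t + k)) ∈ sys.manifestBehavior := by
  obtain ⟨x, hx⟩ := h
  exact ⟨_, shift_mem_fullBehavior hx t⟩

/-- Concatenation of trajectories at a time where the values of `E x` agree. -/
lemma concat_mem_fullBehavior {x x' : ℕ → Fin n → ℝ} {u u' : ℕ → Fin m → ℝ}
    {y y' : ℕ → Fin p → ℝ} (h : (x, u, y) ∈ sys.fullBehavior)
    (h' : (x', u', y') ∈ sys.fullBehavior) {t : ℕ}
    (hE : sys.E.mulVec (x' 0) = sys.E.mulVec (x t)) :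
    (fun k => if k < t then x k else x' (k - t), fun k => if k < t then u k else u' (k - t),
      fun k => if k < t then y k else y' (k - t)) ∈ sys.fullBehavior := by
  intro k
  simp only
  by_cases hk : k < t
  · simp only [hk, if_true]
    refine ⟨?_, (h k).2⟩
    by_cases hk' : k + 1 < t
    · rw [if_pos hk']
      exact (h k).1
    · obtain rfl : t = k + 1 := by omega
      rw [if_neg hk', Nat.sub_self, hE]
      exact (h k).1
  · rw [if_neg hk, if_neg hk, if_neg hk, if_neg (by omega), show k + 1 - t = k - t + 1 by omega]
    exact h' (k - t)

/-- The full behavior as a linear space. -/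
def fullSubmodule (sys : DescriptorSystem n m p) :
    Submodule ℝ ((ℕ → Fin n → ℝ) × (ℕ → Fin m → ℝ) × (ℕ → Fin p → ℝ)) where
  carrier := sys.fullBehavior
  zero_mem' := fun t => by simp
  add_mem' := by
    intro a b ha hb t
    refine ⟨?_, ?_⟩
    · simp only [Prod.fst_add, Prod.snd_add, Pi.add_apply, Matrix.mulVec_add, (ha t).1, (hb t).1]
      abel
    · simp only [Prod.fst_add, Prod.snd_add, Pi.add_apply, Matrix.mulVec_add, (ha t).2, (hb t).2]
      abel
  smul_mem' := by
    intro c a ha t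
    refine ⟨?_, ?_⟩
    · simp only [Prod.smul_fst, Prod.smul_snd, Pi.smul_apply, Matrix.mulVec_smul, (ha t).1,
        smul_add]
    · simp only [Prod.smul_fst, Prod.smul_snd, Pi.smul_apply, Matrix.mulVec_smul, (ha t).2,
        smul_add]

end DescriptorSystem

/-! ### Finite-dimensional estimates and persistent excitation. -/

/-- Small values of the parameters of a linear relation allow solutions with small values of a
continuous function that vanishes at zero. -/
lemma Submodule.exists_small_solution {V Z : Type*} [NormedAddCommGroup V] [NormedSpace ℝ V]
    [FiniteDimensional ℝ V] [NormedAddCommGroup Z] [NormedSpace ℝ Z] [FiniteDimensional ℝ Z]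
    (F : Submodule ℝ (V × Z)) {J : Z → ℝ} (hJ : Continuous J) (hJ0 : J 0 = 0) {η : ℝ}
    (hη : 0 < η) :
    ∃ δ > 0, ∀ v z, (v, z) ∈ F → ‖v‖ < δ → ∃ z', (v, z') ∈ F ∧ J z' < η := by
  let f : F →ₗ[ℝ] V := LinearMap.fst ℝ V Z ∘ₗ F.subtype
  -- A linear section of the projection to `V`; it is continuous by finite dimension and sends 0 to
  -- 0.
  obtain ⟨g, hg⟩ := f.rangeRestrict.exists_rightInverse_of_surjective f.range_rangeRestrict
  let σ : LinearMap.range f →ₗ[ℝ] Z := LinearMap.snd ℝ V Z ∘ₗ F.subtype ∘ₗ g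
  have hcont : Continuous fun v => J (σ v) := hJ.comp σ.continuous_of_finiteDimensional
  have h0 : J (σ 0) < η := by rwa [map_zero, hJ0]
  obtain ⟨δ, hδ, hball⟩ := Metric.eventually_nhds_iff.1 (hcont.continuousAt.eventually_lt_const h0)
  refine ⟨δ, hδ, fun v z hvz hv => ?_⟩
  let v' : LinearMap.range f := ⟨v, ⟨(v, z), hvz⟩, rfl⟩
  have h1 : f (g v') = v := congrArg Subtype.val (LinearMap.congr_fun hg v')
  refine ⟨σ v', ?_, hball (y := v') (by rwa [dist_zero_right])⟩
  have h2 : ((v, σ v') : V × Z) = g v' := Prod.ext h1.symm rfl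
  rw [h2]
  exact (g v').2

/-- A positive definite quadratic form dominates a multiple of the squared norm. -/
lemma Matrix.PosDef.exists_le_dotProduct {d : ℕ} {Q : Matrix (Fin d) (Fin d) ℝ}
    (hQ : Q.PosDef) : ∃ c > 0, ∀ x : Fin d → ℝ, c * ‖x‖ ^ 2 ≤ dotProduct x (Q.mulVec x) := by
  have hcont : Continuous fun x : Fin d → ℝ => dotProduct x (Q.mulVec x) := by fun_prop
  have hpos : ∀ x : Fin d → ℝ, x ≠ 0 → 0 < dotProduct x (Q.mulVec x) := by
    intro x hx
    simpa using hQ.dotProduct_mulVec_pos hx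
  -- The sphere is empty only for d = 0; otherwise c is the minimum of the form on it.
  rcases (Metric.sphere (0 : Fin d → ℝ) 1).eq_empty_or_nonempty with hemp | hne
  · refine ⟨1, one_pos, fun x => ?_⟩
    have hx : x = 0 := by
      by_contra hx
      have : ‖x‖⁻¹ • x ∈ Metric.sphere (0 : Fin d → ℝ) 1 := by
        rw [mem_sphere_zero_iff_norm, norm_smul, norm_inv, norm_norm,
          inv_mul_cancel₀ (norm_ne_zero_iff.2 hx)]
      rw [hemp] at this
      exact this
    simp [hx]
  · obtain ⟨x₀, hx₀, hmin⟩ := (isCompact_sphere (0 : Fin d → ℝ) 1).exists_isMinOn hne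
      hcont.continuousOn
    have hx₀' : x₀ ≠ 0 := by
      rintro rfl
      simp at hx₀
    refine ⟨_, hpos x₀ hx₀', fun x => ?_⟩
    by_cases hx : x = 0
    · simp [hx]
    · have hn : ‖x‖ ≠ 0 := norm_ne_zero_iff.2 hx
      have hmem : ‖x‖⁻¹ • x ∈ Metric.sphere (0 : Fin d → ℝ) 1 := by
        rw [mem_sphere_zero_iff_norm, norm_smul, norm_inv, norm_norm, inv_mul_cancel₀ hn]
      have h1 := isMinOn_iff.1 hmin _ hmem
      rw [Matrix.mulVec_smul, dotProduct_smul, smul_dotProduct, smul_eq_mul, smul_eq_mul,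
        ← mul_assoc] at h1
      calc dotProduct x₀ (Q.mulVec x₀) * ‖x‖ ^ 2
          ≤ (‖x‖⁻¹ * ‖x‖⁻¹ * dotProduct x (Q.mulVec x)) * ‖x‖ ^ 2 := by gcongr
        _ = dotProduct x (Q.mulVec x) := by field_simp

/-- Persistent excitation in terms of functionals of input segments. -/
lemma IsPersistentlyExciting.functional_eq_zero {m T K : ℕ} {u : ℕ → Fin m → ℝ}
    (h : IsPersistentlyExciting T u K) {v : ℕ → Fin m → ℝ} (huv : ∀ k < T, u k = v k)
    (θ : Fin K → Module.Dual ℝ (Fin m → ℝ))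
    (hθ : ∀ j, j + K ≤ T → ∑ k, θ k (v (j + k)) = 0) : θ = 0 := by
  -- Full row rank makes the kernel of the transpose trivial; the coefficients of θ in the standard
  -- basis lie in this kernel.
  have h1 : (hankelMatrix K T u).transpose.rank = Fintype.card (Fin K × Fin m) := by
    rw [Matrix.rank_transpose, Fintype.card_prod, Fintype.card_fin, Fintype.card_fin, mul_comm]
    exact h
  have hθe : ∀ k w, θ k w = ∑ i, w i * θ k (Pi.single i 1) := by
    intro k w
    conv_lhs => rw [pi_eq_sum_univ' w]
    simp [map_sum]
  have h2 : (fun ki : Fin K × Fin m => θ ki.1 (Pi.single ki.2 1)) = 0 := by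
    refine Matrix.eq_zero_of_rank_eq_card h1 ?_
    funext j
    have h3 := hθ j (by omega)
    rw [Pi.zero_apply, ← h3, Matrix.mulVec, dotProduct, Fintype.sum_prod_type]
    refine Finset.sum_congr rfl fun k _ => ?_
    rw [hθe]
    refine Finset.sum_congr rfl fun i _ => ?_
    rw [← huv _ (by omega), Nat.add_comm j k]
    rfl
  funext k
  refine LinearMap.ext fun w => ?_
  rw [hθe]
  exact Finset.sum_eq_zero fun i _ => by rw [congrFun h2 (k, i), Pi.zero_apply, mul_zero]

/-- Extension of a finite sequence by zero. -/
def extendZero {K : ℕ} {V : Type*} [Zero V] (f : Fin K → V) (i : ℕ) : V :=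
  if h : i < K then f ⟨i, h⟩ else 0

lemma extendZero_of_lt {K : ℕ} {V : Type*} [Zero V] (f : Fin K → V) {i : ℕ} (h : i < K) :
    extendZero f i = f ⟨i, h⟩ := dif_pos h

lemma continuous_extendZero {K : ℕ} {V : Type*} [Zero V] [TopologicalSpace V] (i : ℕ) :
    Continuous fun f : Fin K → V => extendZero f i := by
  unfold extendZero
  by_cases h : i < K
  · simp only [h, dif_pos]
    exact continuous_apply _
  · simp only [h]
    exact continuous_const

/-! ### Costs, plans and the fundamental lemma. -/

namespace MPCScheme

variable {n m p : ℕ} (M : MPCScheme n m p)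

/-- The stage cost. -/
noncomputable def stage (v : Fin m → ℝ) (z : Fin p → ℝ) : ℝ :=
  dotProduct z (M.Q.mulVec z) + dotProduct v (M.R.mulVec v)

lemma cost_eq (u : ℕ → Fin m → ℝ) (y : ℕ → Fin p → ℝ) :
    M.cost u y = ∑ k ∈ Finset.range M.L, M.stage (u (M.h + k)) (y (M.h + k)) := rfl

variable {M} in
lemma cost_congr {u u' : ℕ → Fin m → ℝ} {y y' : ℕ → Fin p → ℝ}
    (h : ∀ k, M.h ≤ k → k < M.L + M.h → u k = u' k ∧ y k = y' k) : M.cost u y = M.cost u' y' := by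
  rw [cost_eq, cost_eq]
  refine Finset.sum_congr rfl fun k hk => ?_
  have hk := Finset.mem_range.1 hk
  obtain ⟨h1, h2⟩ := h (M.h + k) (by omega) (by omega)
  rw [h1, h2]

/-- The cost of signals on the prediction window, as a function on a finite-dimensional space. -/
noncomputable def finiteCost
    (z : (Fin (M.L + M.h) → Fin m → ℝ) × (Fin (M.L + M.h) → Fin p → ℝ)) : ℝ :=
  M.cost (extendZero z.1) (extendZero z.2)

/-- The restriction of signals to the prediction window. -/
def restrict (u : ℕ → Fin m → ℝ) (y : ℕ → Fin p → ℝ) :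
    (Fin (M.L + M.h) → Fin m → ℝ) × (Fin (M.L + M.h) → Fin p → ℝ) :=
  (fun i => u i, fun i => y i)

lemma finiteCost_restrict (u : ℕ → Fin m → ℝ) (y : ℕ → Fin p → ℝ) :
    M.finiteCost (M.restrict u y) = M.cost u y :=
  cost_congr fun _ _ hk => ⟨extendZero_of_lt _ hk, extendZero_of_lt _ hk⟩

lemma continuous_stage : Continuous fun a : (Fin m → ℝ) × (Fin p → ℝ) => M.stage a.1 a.2 := by
  unfold stage
  fun_prop

lemma continuous_finiteCost : Continuous M.finiteCost := by
  unfold finiteCost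
  simp only [cost_eq]
  refine continuous_finsetSum _ fun k _ => ?_
  exact M.continuous_stage.comp (((continuous_extendZero (M.h + k)).comp continuous_fst).prodMk
    ((continuous_extendZero (M.h + k)).comp continuous_snd))

lemma finiteCost_zero : M.finiteCost 0 = 0 := by
  have h : ∀ (V : Type) [Zero V] (K i : ℕ), extendZero (0 : Fin K → V) i = 0 := by
    intro V _ K i
    unfold extendZero
    split <;> rfl
  simp [finiteCost, cost_eq, h, stage]

variable {M}

lemma exists_stage_bound (hQ : M.Q.PosDef) (hR : M.R.PosDef) :
    ∃ c > 0, ∀ v z, c * ‖v‖ ^ 2 ≤ M.stage v z ∧ c * ‖z‖ ^ 2 ≤ M.stage v z := by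
  obtain ⟨a, ha, hQa⟩ := hQ.exists_le_dotProduct
  obtain ⟨b, hb, hRb⟩ := hR.exists_le_dotProduct
  refine ⟨min a b, lt_min ha hb, fun v z => ?_⟩
  have h1 := hQa z
  have h2 := hRb v
  have h3 : min a b * ‖z‖ ^ 2 ≤ a * ‖z‖ ^ 2 := by gcongr; exact min_le_left _ _
  have h4 : min a b * ‖v‖ ^ 2 ≤ b * ‖v‖ ^ 2 := by gcongr; exact min_le_right _ _
  have h5 : 0 ≤ a * ‖z‖ ^ 2 := by positivity
  have h6 : 0 ≤ b * ‖v‖ ^ 2 := by positivity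
  unfold stage
  constructor <;> linarith

lemma stage_nonneg (hQ : M.Q.PosDef) (hR : M.R.PosDef) (v : Fin m → ℝ) (z : Fin p → ℝ) :
    0 ≤ M.stage v z := by
  obtain ⟨c, hc, h⟩ := exists_stage_bound hQ hR
  exact le_trans (by positivity) (h v z).1

lemma cost_nonneg (hQ : M.Q.PosDef) (hR : M.R.PosDef) (u : ℕ → Fin m → ℝ) (y : ℕ → Fin p → ℝ) :
    0 ≤ M.cost u y :=
  Finset.sum_nonneg fun _ _ => stage_nonneg hQ hR _ _

lemma stage_le_cost (hQ : M.Q.PosDef) (hR : M.R.PosDef) (u : ℕ → Fin m → ℝ) (y : ℕ → Fin p → ℝ)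
    {k : ℕ} (hk : k < M.L) : M.stage (u (M.h + k)) (y (M.h + k)) ≤ M.cost u y :=
  Finset.single_le_sum (f := fun k => M.stage (u (M.h + k)) (y (M.h + k)))
    (fun _ _ => stage_nonneg hQ hR _ _) (Finset.mem_range.2 hk)

variable (M)

/-- An input-output trajectory that starts with the window `w` and vanishes from the terminal
window on. -/
structure IsPlan (w : M.Window) (u : ℕ → Fin m → ℝ) (y : ℕ → Fin p → ℝ) : Prop where
  mem : (u, y) ∈ M.sys.manifestBehavior
  initial : ∀ i : Fin M.h, u i = w.1 i ∧ y i = w.2 i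
  terminal : ∀ k, M.L ≤ k → u k = 0 ∧ y k = 0

/-- The standing assumptions: coordinates in which the slow subsystem is controllable and
observable, recorded data with persistently exciting input, and a sufficiently long horizon. -/
structure Admissible where
  W : M.sys.Coordinates M.sys.q M.sys.s
  ctrl : W.slow.Controllable M.sys.q
  obs : W.slow.Observable M.sys.q
  data : ((fun k : Fin M.T => M.ubar k), (fun k : Fin M.T => M.ybar k))
      ∈ M.sys.restrictedManifestBehavior M.T
  pe : IsPersistentlyExciting M.T M.ubar (M.L + 2 * (M.sys.q + M.sys.s - 1))
  horizon : 2 * M.sys.q + 3 * M.sys.s ≤ M.L + 2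

variable {M}

namespace Admissible

variable (H : M.Admissible)

include H

lemma h_add_one : M.h + 1 = M.sys.q + M.sys.s :=
  Nat.sub_add_cancel (le_trans H.W.one_le (Nat.le_add_left _ _))

/-- The measured window takes h indices and null control another h; the terminal window, which
starts at index L, must not begin earlier. -/
lemma two_h_le : 2 * M.h ≤ M.L := by
  have := H.horizon
  have := H.h_add_one
  have := H.W.one_le
  omega

lemma s_le_L : M.sys.s ≤ M.L := by
  have := H.horizon
  have := H.W.one_le
  omega

/-- The fundamental lemma: the Hankel matrices of the data parametrize the trajectories of length
`L + h`. -/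
lemma exists_hankel_iff (u : ℕ → Fin m → ℝ) (y : ℕ → Fin p → ℝ) :
    (∃ α : Fin M.numCols → ℝ,
      stackedVector (M.L + M.h) u
        = (hankelMatrix (M.L + M.h) (M.T + 1 - M.sys.s) M.ubar).mulVec α ∧
      stackedVector (M.L + M.h) y
        = (hankelMatrix (M.L + M.h) (M.T + 1 - M.sys.s) M.ybar).mulVec α) ↔
    ∃ v z, (v, z) ∈ M.sys.manifestBehavior ∧ ∀ i < M.L + M.h, u i = v i ∧ y i = z i := by
  have hs := H.W.one_le
  have hL := H.s_le_L
  have hh := H.h_add_one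
  have hWs : H.W.slow.s = M.sys.s := rfl
  obtain ⟨⟨ub, yb⟩, hb, hub, hyb⟩ := H.data
  obtain ⟨ξ, hξ⟩ := H.W.mem_manifest_iff.1 hb
  have hub : ∀ k < M.T, M.ubar k = ub k := fun k hk => hub ⟨k, hk⟩
  have hyb : ∀ k < M.T, M.ybar k = yb k := fun k hk => hyb ⟨k, hk⟩
  have hcol : ∀ {d : ℕ} (f g : ℕ → Fin d → ℝ) (_ : ∀ k < M.T, f k = g k) (w : ℕ → Fin d → ℝ)
      (α : Fin M.numCols → ℝ), stackedVector (M.L + M.h) w =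
        (hankelMatrix (M.L + M.h) (M.T + 1 - M.sys.s) f).mulVec α ↔
      ∀ i < M.L + M.h, w i = ∑ j, α j • g (j + i) := by
    intro d f g hfg w α
    have hval : ∀ (i : Fin (M.L + M.h)) (l : Fin d),
        (hankelMatrix (M.L + M.h) (M.T + 1 - M.sys.s) f).mulVec α (i, l) =
          (∑ j, α j • g (j + i)) l := by
      intro i l
      rw [Finset.sum_apply, Matrix.mulVec, dotProduct]
      refine Finset.sum_congr rfl fun j _ => ?_
      rw [← hfg (j + i) (by omega), Pi.smul_apply, smul_eq_mul, mul_comm, Nat.add_comm j i]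
      rfl
    constructor
    · intro h i hi
      funext l
      rw [← hval ⟨i, hi⟩ l, ← h]
      rfl
    · intro h
      funext ⟨i, l⟩
      rw [hval, ← h i i.2]
      rfl
  simp only [hcol M.ubar ub hub, hcol M.ybar yb hyb]
  let x : ℕ → Fin M.sys.q → ℝ := fun t => H.W.slow.state t (ξ, ub)
  -- By linearity, a combination of shifted data trajectories is the trajectory of the combined
  -- states and inputs.
  have houtx : ∀ α : Fin M.numCols → ℝ, ∀ i,
      H.W.slow.out i (∑ j, α j • x j, fun k => ∑ j, α j • ub (j + k)) = ∑ j, α j • yb (j + i) := by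
    intro α i
    have h1 : ((∑ j, α j • x j, fun k => ∑ j, α j • ub (j + k)) :
        (Fin M.sys.q → ℝ) × (ℕ → Fin m → ℝ)) = ∑ j, α j • (x j, fun k => ub (j + k)) := by
      refine Prod.ext ?_ ?_
      · simp [Prod.fst_sum]
      · funext k
        simp [Prod.snd_sum, Finset.sum_apply]
    rw [h1, map_sum]
    refine Finset.sum_congr rfl fun j _ => ?_
    rw [map_smul, hξ, H.W.slow.out_add]
  constructor
  · rintro ⟨α, hu, hy⟩
    refine ⟨fun k => ∑ j, α j • ub (j + k), fun k => ∑ j, α j • yb (j + k),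
      H.W.mem_manifest_iff.2 ⟨∑ j, α j • x j, fun t => (houtx α t).symm⟩,
      fun i hi => ⟨hu i hi, hy i hi⟩⟩
  · rintro ⟨v, z, hvz, heq⟩
    obtain ⟨ζ, hζ⟩ := H.W.mem_manifest_iff.1 hvz
    -- Outputs on L + h samples depend on L + h + s - 1 inputs, and prescribing the state as well
    -- costs q further orders of excitation.
    have horder : M.L + 2 * (M.sys.q + M.sys.s - 1) = M.L + M.h + M.sys.s - 1 + M.sys.q := by
      omega
    have hpe := H.pe
    rw [horder] at hpe
    obtain ⟨α, hα, hαu⟩ := H.ctrl.exists_combination (K := M.L + M.h + M.sys.s - 1) (T := M.T)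
      (c := M.numCols) (Module.finrank_fintype_fun_eq_card ℝ |>.trans (Fintype.card_fin _))
      (x := x) (u := ub) (fun t => H.W.slow.state_succ t ξ ub) (hpe.functional_eq_zero hub)
      (fun j hj => by unfold numCols; omega) ζ v
    refine ⟨α, fun i hi => ?_, fun i hi => ?_⟩
    · rw [(heq i hi).1, hαu i (by omega)]
    · rw [(heq i hi).2, hζ, ← houtx, hα]
      exact H.W.slow.out_congr (fun k hk => (hαu k (by omega)).symm) ζ

lemma _root_.MPCScheme.IsPlan.exists_isFeasiblePoint {w : M.Window} {u : ℕ → Fin m → ℝ}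
    {y : ℕ → Fin p → ℝ} (h : M.IsPlan w u y) : ∃ α, M.IsFeasiblePoint w u y α := by
  obtain ⟨α, hu, hy⟩ := (H.exists_hankel_iff u y).2 ⟨u, y, h.mem, fun _ _ => ⟨rfl, rfl⟩⟩
  exact ⟨α, hu, hy, h.initial, fun i hi _ => h.terminal i hi⟩

/-- The terminal window consists of h zero samples, exactly the overlap needed to glue the zero
trajectory at index L. -/
lemma exists_isPlan {w : M.Window} {u : ℕ → Fin m → ℝ} {y : ℕ → Fin p → ℝ}
    {α : Fin M.numCols → ℝ} (h : M.IsFeasiblePoint w u y α) :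
    ∃ u' y', M.IsPlan w u' y' ∧ ∀ k < M.L + M.h, u' k = u k ∧ y' k = y k := by
  obtain ⟨v, z, hvz, heq⟩ := (H.exists_hankel_iff u y).1 ⟨α, h.input_eq, h.output_eq⟩
  obtain ⟨u', y', hmem, h1, h2⟩ := H.W.exists_concat H.obs (t := M.L) (u' := 0) (y' := 0) hvz
    ⟨0, M.sys.fullSubmodule.zero_mem⟩ (fun k hk => by
      have hk : k < M.h := hk
      rw [← (heq _ (by omega)).1, ← (heq _ (by omega)).2]
      exact h.terminal _ (by omega) (by omega))
  have h1 : ∀ k < M.L + M.h, u' k = u k ∧ y' k = y k := fun k hk => by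
    rw [(h1 k hk).1, (h1 k hk).2, (heq k hk).1, (heq k hk).2]
    exact ⟨rfl, rfl⟩
  refine ⟨u', y', ⟨hmem, fun i => ?_, fun k hk => ?_⟩, h1⟩
  · rw [(h1 i (by omega)).1, (h1 i (by omega)).2]
    exact h.initial i
  · obtain ⟨j, rfl⟩ := Nat.exists_eq_add_of_le hk
    exact h2 j

lemma isFeasible_iff {w : M.Window} : M.IsFeasible w ↔ ∃ u y, M.IsPlan w u y := by
  constructor
  · rintro ⟨u, y, α, h⟩
    obtain ⟨u', y', h', -⟩ := H.exists_isPlan h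
    exact ⟨u', y', h'⟩
  · rintro ⟨u, y, h⟩
    obtain ⟨α, hα⟩ := h.exists_isFeasiblePoint H
    exact ⟨u, y, α, hα⟩

/-- Any trajectory can be continued after the initial window to a plan without changing `E x`
at the end of the window. -/
lemma exists_isPlan_of_mem {x : ℕ → Fin n → ℝ} {u : ℕ → Fin m → ℝ} {y : ℕ → Fin p → ℝ}
    (h : (x, u, y) ∈ M.sys.fullBehavior) :
    ∃ x' u' y', (x', u', y') ∈ M.sys.fullBehavior ∧ M.IsPlan (M.window u y 0) u' y' ∧
      M.sys.E.mulVec (x' M.h) = M.sys.E.mulVec (x M.h) := by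
  obtain ⟨x', u', y', h', hE, h0⟩ :=
    H.W.exists_null_control H.ctrl (DescriptorSystem.shift_mem_fullBehavior h M.h)
  have hc := DescriptorSystem.concat_mem_fullBehavior h h' (t := M.h) hE
  refine ⟨_, _, _, hc, ⟨⟨_, hc⟩, fun i => ?_, fun k hk => ?_⟩, ?_⟩
  · simp [window]
  · have := H.two_h_le
    have h2 : M.sys.q + M.sys.s - 1 = M.h := rfl
    simp only [show ¬ k < M.h by omega, if_false]
    exact h0 _ (by omega)
  · simpa using hE

end Admissible

end MPCScheme

/-! ### Runs of the scheme: optimal solutions, recursive feasibility, decrease of the value. -/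

namespace MPCScheme

variable {n m p : ℕ} {M : MPCScheme n m p}

/-- A step at time t reads no realized sample beyond index t + h, so it survives later changes of
the signals. Infinite runs are built on this. -/
lemma IsStep.congr {u u' : ℕ → Fin m → ℝ} {y y' : ℕ → Fin p → ℝ} {t : ℕ}
    (h : M.IsStep u y t) (heq : ∀ k < t + M.h + 1, u' k = u k ∧ y' k = y k) :
    M.IsStep u' y' t := by
  obtain ⟨uh, yh, α, hopt, upl, ypl, hpl, hpast, hfut, hu, hy⟩ := h
  have hw : M.window u' y' t = M.window u y t :=
    Prod.ext (funext fun i => (heq _ (by omega)).1) (funext fun i => (heq _ (by omega)).2)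
  refine ⟨uh, yh, α, hw ▸ hopt, upl, ypl, hpl, fun k hk => ?_, hfut, ?_, ?_⟩
  · rw [(heq k (by omega)).1, (heq k (by omega)).2]
    exact hpast k hk
  · rw [(heq _ (by omega)).1, hu]
  · rw [(heq _ (by omega)).2, hy]

namespace Admissible

variable (H : M.Admissible)

include H

/-- The feasible optimal control problem has an optimal solution. -/
lemma exists_isOptimal (hQ : M.Q.PosDef) (hR : M.R.PosDef) {w : M.Window} (hw : M.IsFeasible w) :
    ∃ u y α, M.IsOptimal w u y α := by
  obtain ⟨u₀, y₀, h₀⟩ := H.isFeasible_iff.1 hw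
  obtain ⟨c, hc, hstage⟩ := exists_stage_bound hQ hR
  let plans : Submodule ℝ ((Fin (M.L + M.h) → Fin m → ℝ) × (Fin (M.L + M.h) → Fin p → ℝ)) :=
    { carrier := {z | ∃ x u y, (x, u, y) ∈ M.sys.fullBehavior ∧
        (∀ k, M.L ≤ k → u k = 0 ∧ y k = 0) ∧ M.restrict u y = z}
      zero_mem' := ⟨0, 0, 0, M.sys.fullSubmodule.zero_mem, fun _ _ => ⟨rfl, rfl⟩, rfl⟩
      add_mem' := by
        rintro _ _ ⟨x, u, y, h, h0, rfl⟩ ⟨x', u', y', h', h0', rfl⟩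
        refine ⟨x + x', u + u', y + y', M.sys.fullSubmodule.add_mem h h', fun k hk => ?_, rfl⟩
        simp [h0 k hk, h0' k hk]
      smul_mem' := by
        rintro a _ ⟨x, u, y, h, h0, rfl⟩
        refine ⟨a • x, a • u, a • y, M.sys.fullSubmodule.smul_mem a h, fun k hk => ?_, rfl⟩
        simp [h0 k hk] }
  -- Sublevel set of the cost of a known plan. It is compact: the initial entries are fixed by w,
  -- and the stage cost bounds all others.
  let S : Set ((Fin (M.L + M.h) → Fin m → ℝ) × (Fin (M.L + M.h) → Fin p → ℝ)) :=
    {z | z ∈ plans ∧ (∀ i : Fin M.h, extendZero z.1 i = w.1 i ∧ extendZero z.2 i = w.2 i) ∧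
      M.finiteCost z ≤ M.cost u₀ y₀}
  have hplan : ∀ {u y}, M.IsPlan w u y → M.cost u y ≤ M.cost u₀ y₀ → M.restrict u y ∈ S := by
    intro u y h hle
    obtain ⟨x, hx⟩ := h.mem
    refine ⟨⟨x, u, y, hx, h.terminal, rfl⟩, fun i => ?_, by rwa [finiteCost_restrict]⟩
    have hi : (i : ℕ) < M.L + M.h := by omega
    rw [extendZero_of_lt _ hi, extendZero_of_lt _ hi]
    exact h.initial i
  have hclosed : IsClosed S := by
    have hS : S = (plans : Set _) ∩ ((⋂ i : Fin M.h, {z | extendZero z.1 i = w.1 i} ∩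
        {z | extendZero z.2 i = w.2 i}) ∩ {z | M.finiteCost z ≤ M.cost u₀ y₀}) := by
      ext z
      simp only [S, Set.mem_ofPred_eq, Set.mem_inter_iff, Set.mem_iInter, SetLike.mem_coe]
    rw [hS]
    refine plans.closed_of_finiteDimensional.inter (IsClosed.inter (isClosed_iInter fun i => ?_)
      (isClosed_le M.continuous_finiteCost continuous_const))
    exact (isClosed_eq ((continuous_extendZero _).comp continuous_fst) continuous_const).inter
      (isClosed_eq ((continuous_extendZero _).comp continuous_snd) continuous_const)
  have hbdd : Bornology.IsBounded S := by
    obtain ⟨ρ, hρ, hρc⟩ : ∃ ρ ≥ 0, c * ρ ^ 2 = M.cost u₀ y₀ :=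
      ⟨√(M.cost u₀ y₀ / c), Real.sqrt_nonneg _, by
        rw [Real.sq_sqrt (div_nonneg (cost_nonneg hQ hR _ _) hc.le)]
        field_simp⟩
    refine isBounded_iff_forall_norm_le.2 ⟨max ‖w‖ ρ, fun z hz => ?_⟩
    have hmax : 0 ≤ max ‖w‖ ρ := le_max_of_le_right hρ
    have hk : ∀ k (hk : k < M.L + M.h), ‖z.1 ⟨k, hk⟩‖ ≤ max ‖w‖ ρ ∧
        ‖z.2 ⟨k, hk⟩‖ ≤ max ‖w‖ ρ := by
      intro k hk
      rw [← extendZero_of_lt z.1 hk, ← extendZero_of_lt z.2 hk]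
      by_cases hkh : k < M.h
      · obtain ⟨h1, h2⟩ := hz.2.1 ⟨k, hkh⟩
        simp only at h1 h2
        rw [h1, h2]
        exact ⟨le_max_of_le_left ((norm_le_pi_norm _ _).trans (norm_fst_le w)),
          le_max_of_le_left ((norm_le_pi_norm _ _).trans (norm_snd_le w))⟩
      · obtain ⟨j, rfl⟩ := Nat.exists_eq_add_of_le (not_lt.1 hkh)
        have h1 := stage_le_cost hQ hR (extendZero z.1) (extendZero z.2) (k := j) (by omega)
        have h2 := hstage (extendZero z.1 (M.h + j)) (extendZero z.2 (M.h + j))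
        have h3 : M.cost (extendZero z.1) (extendZero z.2) ≤ c * ρ ^ 2 := hρc ▸ hz.2.2
        have h4 : ∀ a : ℝ, c * a ^ 2 ≤ c * ρ ^ 2 → a ≤ ρ := fun a ha =>
          le_of_sq_le_sq (le_of_mul_le_mul_left ha hc) hρ
        exact ⟨le_max_of_le_right (h4 _ (h2.1.trans (h1.trans h3))),
          le_max_of_le_right (h4 _ (h2.2.trans (h1.trans h3)))⟩
    exact max_le ((pi_norm_le_iff_of_nonneg hmax).2 fun i => (hk i i.2).1)
      ((pi_norm_le_iff_of_nonneg hmax).2 fun i => (hk i i.2).2)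
  obtain ⟨z, hz, hmin⟩ := (Metric.isCompact_of_isClosed_isBounded hclosed hbdd).exists_isMinOn
    ⟨_, hplan h₀ le_rfl⟩ M.continuous_finiteCost.continuousOn
  obtain ⟨⟨x, u, y, hx, hterm, rfl⟩, hinit, hle⟩ := hz
  have hP : M.IsPlan w u y := by
    refine ⟨⟨x, hx⟩, fun i => ?_, hterm⟩
    have hi : (i : ℕ) < M.L + M.h := by omega
    have h1 := hinit i
    rwa [extendZero_of_lt _ hi, extendZero_of_lt _ hi] at h1
  obtain ⟨α, hα⟩ := hP.exists_isFeasiblePoint H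
  refine ⟨u, y, α, hα, fun u₂ y₂ α₂ h₂ => ?_⟩
  obtain ⟨u₃, y₃, h₃, heq⟩ := H.exists_isPlan h₂
  have hcost : M.cost u₃ y₃ = M.cost u₂ y₂ := cost_congr fun k _ hk => heq k hk
  rw [← hcost, ← M.finiteCost_restrict u y]
  by_cases hle₃ : M.cost u₃ y₃ ≤ M.cost u₀ y₀
  · have h4 := isMinOn_iff.1 hmin _ (hplan h₃ hle₃)
    rwa [finiteCost_restrict M u₃] at h4
  · exact hle.trans (not_le.1 hle₃).le

/-- After a step the realized signals are still the beginning of a trajectory. -/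
lemma exists_trajectory_of_isStep {u : ℕ → Fin m → ℝ} {y : ℕ → Fin p → ℝ} {t : ℕ}
    (h : M.IsStep u y t) :
    ∃ v z, (v, z) ∈ M.sys.manifestBehavior ∧ ∀ k < t + M.h + 1, v k = u k ∧ z k = y k := by
  obtain ⟨uh, yh, α, hopt, upl, ypl, hpl, hpast, hfut, hu, hy⟩ := h
  refine ⟨upl, ypl, hpl, fun k hk => ?_⟩
  rcases Nat.lt_succ_iff_lt_or_eq.1 hk with hk | rfl
  · exact hpast k hk
  · have hL : 0 < M.L := H.W.one_le.trans H.s_le_L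
    exact ⟨(hfut 0 hL).trans hu.symm, hy.symm⟩

lemma exists_trajectory_of_isRunUpTo {u : ℕ → Fin m → ℝ} {y : ℕ → Fin p → ℝ} {t : ℕ}
    (h0 : M.IsFeasible (M.window u y 0)) (h : M.IsRunUpTo u y t) :
    ∃ v z, (v, z) ∈ M.sys.manifestBehavior ∧ ∀ k < t + M.h, v k = u k ∧ z k = y k := by
  cases t with
  | zero =>
    obtain ⟨v, z, hp⟩ := H.isFeasible_iff.1 h0
    refine ⟨v, z, hp.mem, fun k hk => ?_⟩
    have := hp.initial ⟨k, by omega⟩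
    simpa [window] using this
  | succ t =>
    obtain ⟨v, z, hvz, heq⟩ := H.exists_trajectory_of_isStep (h t t.lt_succ_self)
    exact ⟨v, z, hvz, fun k hk => heq k (by omega)⟩

/-- Windows of trajectories are feasible. -/
lemma isFeasible_window {u v : ℕ → Fin m → ℝ} {y z : ℕ → Fin p → ℝ} {t : ℕ}
    (h : (v, z) ∈ M.sys.manifestBehavior) (heq : ∀ k < t + M.h, v k = u k ∧ z k = y k) :
    M.IsFeasible (M.window u y t) := by
  obtain ⟨x, hx⟩ := h
  obtain ⟨x', u', y', -, hp, -⟩ :=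
    H.exists_isPlan_of_mem (DescriptorSystem.shift_mem_fullBehavior hx t)
  have hw : M.window (fun k => v (t + k)) (fun k => z (t + k)) 0 = M.window u y t := by
    refine Prod.ext (funext fun i => ?_) (funext fun i => ?_)
    · have := (heq (t + i) (by omega)).1
      simpa [window] using this
    · have := (heq (t + i) (by omega)).2
      simpa [window] using this
  exact H.isFeasible_iff.2 ⟨u', y', hw ▸ hp⟩

lemma isFeasible_of_isRunUpTo {u : ℕ → Fin m → ℝ} {y : ℕ → Fin p → ℝ} {t : ℕ}
    (h0 : M.IsFeasible (M.window u y 0)) (h : M.IsRunUpTo u y t) :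
    M.IsFeasible (M.window u y t) := by
  obtain ⟨v, z, hvz, heq⟩ := H.exists_trajectory_of_isRunUpTo h0 h
  exact H.isFeasible_window hvz heq

/-- The scheme can carry out the next step. -/
lemma exists_isStep (hQ : M.Q.PosDef) (hR : M.R.PosDef) {u : ℕ → Fin m → ℝ}
    {y : ℕ → Fin p → ℝ} {t : ℕ} (h0 : M.IsFeasible (M.window u y 0)) (h : M.IsRunUpTo u y t) :
    ∃ u' y', (∀ k < t + M.h, u' k = u k ∧ y' k = y k) ∧ M.IsStep u' y' t := by
  obtain ⟨uh, yh, α, hopt⟩ := H.exists_isOptimal hQ hR (H.isFeasible_of_isRunUpTo h0 h)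
  obtain ⟨v, z, hvz, heq⟩ := H.exists_trajectory_of_isRunUpTo h0 h
  obtain ⟨uq, yq, hq, hqeq⟩ := H.exists_isPlan hopt.1
  -- The realized past and the optimal plan share the current window; their concatenation is the
  -- response of the system.
  obtain ⟨u', y', hmem, hpast, hfut⟩ := H.W.exists_concat H.obs (t := t) hvz hq.mem
    (fun k hk => by
      have hk : k < M.h := hk
      rw [(heq (t + k) (by omega)).1, (heq (t + k) (by omega)).2, (hq.initial ⟨k, hk⟩).1,
        (hq.initial ⟨k, hk⟩).2]
      exact ⟨rfl, rfl⟩)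
  have hpast : ∀ k < t + M.h, u' k = u k ∧ y' k = y k := fun k hk => by
    rw [(hpast k hk).1, (hpast k hk).2]
    exact heq k hk
  have hw : M.window u' y' t = M.window u y t :=
    Prod.ext (funext fun i => (hpast _ (by omega)).1) (funext fun i => (hpast _ (by omega)).2)
  have hL : 0 < M.L := H.W.one_le.trans H.s_le_L
  refine ⟨u', y', hpast, uh, yh, α, hw ▸ hopt, u', y', hmem, fun _ _ => ⟨rfl, rfl⟩,
    fun k hk => ?_, ?_, rfl⟩
  · rw [add_assoc, (hfut _).1, (hqeq _ (by omega)).1]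
  · rw [(hfut _).1, (hqeq _ (by omega)).1]

/-- Every finite run of the scheme can be continued for all times. -/
lemma exists_isRun (hQ : M.Q.PosDef) (hR : M.R.PosDef) {u : ℕ → Fin m → ℝ}
    {y : ℕ → Fin p → ℝ} {t : ℕ} (h0 : M.IsFeasible (M.window u y 0)) (h : M.IsRunUpTo u y t) :
    ∃ u' y', (∀ k < t + M.h, u' k = u k ∧ y' k = y k) ∧ M.IsRun u' y' := by
  have hext : ∀ (k : ℕ) (b : (ℕ → Fin m → ℝ) × (ℕ → Fin p → ℝ)),
      ∃ b' : (ℕ → Fin m → ℝ) × (ℕ → Fin p → ℝ),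
        (M.IsFeasible (M.window b.1 b.2 0) ∧ M.IsRunUpTo b.1 b.2 (t + k)) →
        (∀ i < t + k + M.h, b'.1 i = b.1 i ∧ b'.2 i = b.2 i) ∧ M.IsStep b'.1 b'.2 (t + k) := by
    intro k b
    by_cases hb : M.IsFeasible (M.window b.1 b.2 0) ∧ M.IsRunUpTo b.1 b.2 (t + k)
    · obtain ⟨u', y', h'⟩ := H.exists_isStep hQ hR hb.1 hb.2
      exact ⟨(u', y'), fun _ => h'⟩
    · exact ⟨b, fun hb' => absurd hb' hb⟩
  choose F hF using hext
  let b : ℕ → (ℕ → Fin m → ℝ) × (ℕ → Fin p → ℝ) := fun k => Nat.rec (u, y) F k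
  have hb : ∀ k, M.IsFeasible (M.window (b k).1 (b k).2 0) ∧
      M.IsRunUpTo (b k).1 (b k).2 (t + k) := by
    intro k
    induction k with
    | zero => exact ⟨h0, h⟩
    | succ k ih =>
      obtain ⟨hold, hstep⟩ := hF k (b k) ih
      have hw : M.window (b (k + 1)).1 (b (k + 1)).2 0 = M.window (b k).1 (b k).2 0 :=
        Prod.ext (funext fun i => (hold _ (by omega)).1) (funext fun i => (hold _ (by omega)).2)
      refine ⟨hw ▸ ih.1, fun j hj => ?_⟩
      rcases (by omega : j < t + k ∨ j = t + k) with hj | rfl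
      · exact (ih.2 j hj).congr fun i hi => hold i (by omega)
      · exact hstep
  have hagree : ∀ k d, ∀ i < t + k + M.h,
      (b (k + d)).1 i = (b k).1 i ∧ (b (k + d)).2 i = (b k).2 i := by
    intro k d
    induction d with
    | zero => exact fun _ _ => ⟨rfl, rfl⟩
    | succ d ih =>
      intro i hi
      obtain ⟨h1, h2⟩ := (hF (k + d) (b (k + d)) (hb _)).1 i (by omega)
      exact ⟨h1.trans (ih i hi).1, h2.trans (ih i hi).2⟩
  -- Index i no longer changes from stage i + 1 on, so the diagonal sequence agrees with every stage
  -- on its settled part.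
  have hlim : ∀ k, ∀ i < t + k + M.h,
      (b (i + 1)).1 i = (b k).1 i ∧ (b (i + 1)).2 i = (b k).2 i := by
    intro k i hi
    rcases le_total k (i + 1) with hle | hle
    · obtain ⟨d, hd⟩ := Nat.exists_eq_add_of_le hle
      rw [hd]
      exact hagree k d i hi
    · obtain ⟨d, rfl⟩ := Nat.exists_eq_add_of_le hle
      obtain ⟨h1, h2⟩ := hagree (i + 1) d i (by omega)
      exact ⟨h1.symm, h2.symm⟩
  refine ⟨fun i => (b (i + 1)).1 i, fun i => (b (i + 1)).2 i, fun k hk => hlim 0 k hk,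
    fun j => ?_⟩
  exact ((hb (j + 1)).2 j (by omega)).congr fun i hi => hlim (j + 1) i (by omega)

lemma mem_manifest_of_isRun {u : ℕ → Fin m → ℝ} {y : ℕ → Fin p → ℝ} (h : M.IsRun u y) :
    (u, y) ∈ M.sys.manifestBehavior := by
  refine H.W.mem_manifest_of_forall H.obs fun K => ?_
  obtain ⟨v, z, hvz, heq⟩ := H.exists_trajectory_of_isStep (h K)
  exact ⟨v, z, hvz, fun k hk => heq k (by omega)⟩

/-- In each step the measured output is the predicted one. -/
lemma output_eq {u uh uq : ℕ → Fin m → ℝ} {y yh yq : ℕ → Fin p → ℝ} {t : ℕ}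
    (hq : M.IsPlan (M.window u y t) uq yq)
    (hqeq : ∀ k < M.L + M.h, uq k = uh k ∧ yq k = yh k)
    {upl : ℕ → Fin m → ℝ} {ypl : ℕ → Fin p → ℝ} (hpl : (upl, ypl) ∈ M.sys.manifestBehavior)
    (hpast : ∀ k < t + M.h, upl k = u k ∧ ypl k = y k)
    (hfut : ∀ k < M.L, upl (t + M.h + k) = uh (M.h + k)) : ypl (t + M.h) = yq M.h := by
  have hwin : ∀ i < M.h, upl (t + i) = uq i ∧ ypl (t + i) = yq i := by
    intro i hi
    obtain ⟨h1, h2⟩ := hpast (t + i) (by omega)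
    obtain ⟨h3, h4⟩ := hq.initial ⟨i, hi⟩
    exact ⟨h1.trans h3.symm, h2.trans h4.symm⟩
  refine H.W.output_unique H.obs (DescriptorSystem.shift_mem_manifestBehavior hpl t) hq.mem
    (fun i hi => ?_) (fun i hi => (hwin i hi).1) (fun i hi => (hwin i hi).2)
  -- The output at index h looks ahead to index h + s - 1, which the L planned inputs cover.
  have := H.s_le_L
  by_cases hih : i < M.h
  · exact (hwin i hih).1
  · obtain ⟨j, rfl⟩ := Nat.exists_eq_add_of_le (not_lt.1 hih)
    rw [← add_assoc, hfut j (by omega), (hqeq _ (by omega)).1]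

/-- The optimal value decreases along a run by at least the stage cost. -/
lemma exists_value (hQ : M.Q.PosDef) (hR : M.R.PosDef) {u : ℕ → Fin m → ℝ} {y : ℕ → Fin p → ℝ}
    (h : M.IsRun u y) :
    ∃ V : ℕ → ℝ, (∀ t, 0 ≤ V t) ∧
      (∀ t, V (t + 1) + M.stage (u (t + M.h)) (y (t + M.h)) ≤ V t) ∧
      ∀ v z, M.IsPlan (M.window u y 0) v z → V 0 ≤ M.cost v z := by
  choose uh yh α hopt upl ypl hpl hpast hfut hu hy using h
  have hle : ∀ t v z, M.IsPlan (M.window u y t) v z → M.cost (uh t) (yh t) ≤ M.cost v z := by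
    intro t v z hvz
    obtain ⟨β, hβ⟩ := hvz.exists_isFeasiblePoint H
    exact (hopt t).2 v z β hβ
  refine ⟨fun t => M.cost (uh t) (yh t), fun t => cost_nonneg hQ hR _ _, fun t => ?_, hle 0⟩
  obtain ⟨uq, yq, hq, hqeq⟩ := H.exists_isPlan (hopt t).1
  have hL : 0 < M.L := H.W.one_le.trans H.s_le_L
  have hyq : y (t + M.h) = yq M.h := by
    rw [hy, H.output_eq hq hqeq (hpl t) (hpast t) (hfut t)]
  have huq : u (t + M.h) = uq M.h := by
    rw [hu, (hqeq _ (by omega)).1]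
  -- The realized sample equals the predicted one, so the shifted plan starts with the next measured
  -- window.
  have hshift : M.IsPlan (M.window u y (t + 1)) (fun k => uq (1 + k)) (fun k => yq (1 + k)) := by
    refine ⟨DescriptorSystem.shift_mem_manifestBehavior hq.mem 1, fun i => ?_, fun k hk =>
      hq.terminal _ (by omega)⟩
    by_cases hi : (i : ℕ) + 1 < M.h
    · obtain ⟨h1, h2⟩ := hq.initial ⟨i + 1, hi⟩
      simp only [window] at h1 h2 ⊢
      rw [add_comm 1, h1, h2, add_assoc, add_comm 1]
      exact ⟨rfl, rfl⟩
    · have hi : (i : ℕ) + 1 = M.h := by omega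
      simp only [window]
      rw [add_assoc, add_comm 1, hi, huq, hyq]
      exact ⟨rfl, rfl⟩
  have h1 := hle (t + 1) _ _ hshift
  have h2 : M.cost (uh t) (yh t) = M.cost uq yq :=
    (cost_congr fun k _ hk => hqeq k hk).symm
  have h3 : M.cost (fun k => uq (1 + k)) (fun k => yq (1 + k)) +
      M.stage (uq M.h) (yq M.h) = M.cost uq yq := by
    -- The shift drops the stage at index h and appends the one at h + L, which is zero.
    have h4 : M.stage (uq (M.h + M.L)) (yq (M.h + M.L)) = 0 := by
      obtain ⟨h5, h6⟩ := hq.terminal (M.h + M.L) (by omega)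
      simp [h5, h6, stage]
    have h5 := Finset.sum_range_succ (fun k => M.stage (uq (M.h + k)) (yq (M.h + k))) M.L
    rw [Finset.sum_range_succ', h4, add_zero, add_zero] at h5
    rw [cost_eq, cost_eq, ← h5]
    congr 1
    refine Finset.sum_congr rfl fun k _ => ?_
    rw [show 1 + (M.h + k) = M.h + (k + 1) by omega]
  simp only
  rw [h2, ← h3, huq, hyq]
  linarith

end Admissible

end MPCScheme

/-! ### Stability, convergence and the domain of attraction. -/

namespace MPCScheme

variable {n m p : ℕ} {M : MPCScheme n m p}

/-- Small data of a trajectory that depend linearly on it allow plans of small cost. -/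
lemma exists_small_plan {V : Type*} [NormedAddCommGroup V] [NormedSpace ℝ V]
    [FiniteDimensional ℝ V]
    (f : ((ℕ → Fin n → ℝ) × (ℕ → Fin m → ℝ) × (ℕ → Fin p → ℝ)) →ₗ[ℝ] V) {η : ℝ} (hη : 0 < η) :
    ∃ δ > 0, ∀ x u y, (x, u, y) ∈ M.sys.fullBehavior → (∀ k, M.L ≤ k → u k = 0 ∧ y k = 0) →
      ‖f (x, u, y)‖ < δ → ∃ x' u' y', (x', u', y') ∈ M.sys.fullBehavior ∧
        (∀ k, M.L ≤ k → u' k = 0 ∧ y' k = 0) ∧ f (x', u', y') = f (x, u, y) ∧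
        M.cost u' y' < η := by
  let Z := (Fin (M.L + M.h) → Fin m → ℝ) × (Fin (M.L + M.h) → Fin p → ℝ)
  -- Pairs of data and restricted signals form a linear relation, whose section selects a cheap
  -- trajectory with the same data.
  let F : Submodule ℝ (V × Z) :=
    { carrier := {a | ∃ x u y, (x, u, y) ∈ M.sys.fullBehavior ∧
        (∀ k, M.L ≤ k → u k = 0 ∧ y k = 0) ∧ f (x, u, y) = a.1 ∧ M.restrict u y = a.2}
      zero_mem' := ⟨0, 0, 0, M.sys.fullSubmodule.zero_mem, fun _ _ => ⟨rfl, rfl⟩, map_zero f, rfl⟩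
      add_mem' := by
        rintro ⟨_, _⟩ ⟨_, _⟩ ⟨x, u, y, h, h0, rfl, rfl⟩ ⟨x', u', y', h', h0', rfl, rfl⟩
        refine ⟨x + x', u + u', y + y', M.sys.fullSubmodule.add_mem h h', fun k hk => ?_,
          map_add f (x, u, y) (x', u', y'), rfl⟩
        simp [h0 k hk, h0' k hk]
      smul_mem' := by
        rintro a ⟨_, _⟩ ⟨x, u, y, h, h0, rfl, rfl⟩
        refine ⟨a • x, a • u, a • y, M.sys.fullSubmodule.smul_mem a h, fun k hk => ?_,
          map_smul f a (x, u, y), rfl⟩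
        simp [h0 k hk] }
  obtain ⟨δ, hδ, hsmall⟩ := F.exists_small_solution M.continuous_finiteCost M.finiteCost_zero hη
  refine ⟨δ, hδ, fun x u y h h0 hf => ?_⟩
  obtain ⟨_, ⟨x', u', y', h', h0', hf', rfl⟩, hcost⟩ :=
    hsmall _ (M.restrict u y) ⟨x, u, y, h, h0, rfl, rfl⟩ hf
  rw [finiteCost_restrict] at hcost
  exact ⟨x', u', y', h', h0', hf', hcost⟩

namespace Admissible

variable (H : M.Admissible)

include H

/-- State, input and output are small if the stage cost is small from then on. -/
lemma exists_stage_small (hQ : M.Q.PosDef) (hR : M.R.PosDef) {ε : ℝ} (hε : 0 < ε) :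
    ∃ η > 0, ∀ x u y, (x, u, y) ∈ M.sys.fullBehavior → ∀ t,
      (∀ k, t ≤ k → M.stage (u k) (y k) < η) → ‖(x t, u t, y t)‖ < ε := by
  obtain ⟨c, hc, hstage⟩ := exists_stage_bound hQ hR
  let K := M.sys.q + M.sys.s
  let F : Submodule ℝ (((Fin K → Fin m → ℝ) × (Fin K → Fin p → ℝ)) × (Fin n → ℝ)) :=
    M.sys.fullSubmodule.map (LinearMap.prod
      (LinearMap.prod
        ((LinearMap.funLeft ℝ (Fin m → ℝ) ((↑) : Fin K → ℕ)) ∘ₗ LinearMap.fst ℝ _ _ ∘ₗ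
          LinearMap.snd ℝ _ _)
        ((LinearMap.funLeft ℝ (Fin p → ℝ) ((↑) : Fin K → ℕ)) ∘ₗ LinearMap.snd ℝ _ _ ∘ₗ
          LinearMap.snd ℝ _ _))
      (LinearMap.proj 0 ∘ₗ LinearMap.fst ℝ (ℕ → Fin n → ℝ) _))
  have hF0 : ∀ z, ((0 : (Fin K → Fin m → ℝ) × (Fin K → Fin p → ℝ)), z) ∈ F → z = 0 := by
    rintro z ⟨⟨x, u, y⟩, h, heq⟩
    have h1 := congrArg (fun a => a.1.1) heq
    have h2 := congrArg (fun a => a.1.2) heq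
    have h3 := congrArg (fun a => a.2) heq
    rw [← show x 0 = z from h3]
    exact H.W.state_eq_zero H.obs h fun k hk => ⟨congrFun h1 ⟨k, hk⟩, congrFun h2 ⟨k, hk⟩⟩
  obtain ⟨δ, hδ, hsmall⟩ := F.exists_small_solution (J := fun z => ‖z‖) continuous_norm
    norm_zero hε
  obtain ⟨ρ, hρ, hρδ, hρε⟩ : ∃ ρ > 0, ρ < δ ∧ ρ < ε :=
    ⟨min δ ε / 2, by positivity, (half_lt_self (by positivity)).trans_le (min_le_left _ _),
      (half_lt_self (by positivity)).trans_le (min_le_right _ _)⟩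
  refine ⟨c * ρ ^ 2, by positivity, fun x u y h t ht => ?_⟩
  have hle : ∀ k, t ≤ k → ‖u k‖ ≤ ρ ∧ ‖y k‖ ≤ ρ := by
    intro k hk
    obtain ⟨h1, h2⟩ := hstage (u k) (y k)
    have h3 : ∀ a : ℝ, c * a ^ 2 ≤ c * ρ ^ 2 → a ≤ ρ := fun a ha =>
      le_of_sq_le_sq (le_of_mul_le_mul_left ha hc) hρ.le
    exact ⟨h3 _ (h1.trans (ht k hk).le), h3 _ (h2.trans (ht k hk).le)⟩
  have hx : ‖x t‖ < ε := by
    have hmem : (((fun k : Fin K => u (t + k)), (fun k : Fin K => y (t + k))), x t) ∈ F :=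
      ⟨_, DescriptorSystem.shift_mem_fullBehavior h t, rfl⟩
    obtain ⟨z, hz, hzε⟩ := hsmall _ _ hmem (lt_of_le_of_lt (max_le
      ((pi_norm_le_iff_of_nonneg hρ.le).2 fun k => (hle (t + k) (Nat.le_add_right _ _)).1)
      ((pi_norm_le_iff_of_nonneg hρ.le).2 fun k => (hle (t + k) (Nat.le_add_right _ _)).2)) hρδ)
    -- Both z and x(t) belong to the same samples; by observability the samples determine the state,
    -- so they coincide.
    have h1 := F.sub_mem hmem hz
    rw [Prod.mk_sub_mk, sub_self] at h1
    rwa [sub_eq_zero.1 (hF0 _ h1)]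
  exact max_lt hx (max_lt ((hle t le_rfl).1.trans_lt hρε) ((hle t le_rfl).2.trans_lt hρε))

/-- Small initial windows have plans of small cost. -/
lemma exists_small_plan_of_window {η : ℝ} (hη : 0 < η) :
    ∃ δ > 0, ∀ x u y, (x, u, y) ∈ M.sys.fullBehavior → ‖M.window u y 0‖ < δ →
      ∃ u' y', M.IsPlan (M.window u y 0) u' y' ∧ M.cost u' y' < η := by
  let f : ((ℕ → Fin n → ℝ) × (ℕ → Fin m → ℝ) × (ℕ → Fin p → ℝ)) →ₗ[ℝ]
      (Fin M.h → Fin m → ℝ) × (Fin M.h → Fin p → ℝ) :=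
    { toFun := fun b => (fun i => b.2.1 i, fun i => b.2.2 i)
      map_add' := fun _ _ => rfl
      map_smul' := fun _ _ => rfl }
  obtain ⟨δ, hδ, hsmall⟩ := exists_small_plan f hη
  refine ⟨δ, hδ, fun x u y h hw => ?_⟩
  obtain ⟨x₁, u₁, y₁, h₁, hp, -⟩ := H.exists_isPlan_of_mem h
  have hf : f (x₁, u₁, y₁) = M.window u y 0 :=
    Prod.ext (funext fun i => (hp.initial i).1) (funext fun i => (hp.initial i).2)
  obtain ⟨x', u', y', h', h0', hf', hcost⟩ := hsmall x₁ u₁ y₁ h₁ hp.terminal (hf ▸ hw)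
  rw [hf] at hf'
  exact ⟨u', y', ⟨⟨x', h'⟩, fun i => ⟨congrFun (congrArg Prod.fst hf') i,
    congrFun (congrArg Prod.snd hf') i⟩, h0'⟩, hcost⟩

/-- Trajectories with a small value of `E x` after the initial window have plans of small cost. -/
lemma exists_small_plan_of_state {η : ℝ} (hη : 0 < η) :
    ∃ δ > 0, ∀ x u y, (x, u, y) ∈ M.sys.fullBehavior → ‖M.sys.E.mulVec (x M.h)‖ < δ →
      ∃ u' y', M.IsPlan (M.window u y 0) u' y' ∧ M.cost u' y' < η := by
  let f : ((ℕ → Fin n → ℝ) × (ℕ → Fin m → ℝ) × (ℕ → Fin p → ℝ)) →ₗ[ℝ] (Fin n → ℝ) :=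
    M.sys.E.mulVecLin ∘ₗ LinearMap.proj M.h ∘ₗ LinearMap.fst ℝ _ _
  obtain ⟨δ, hδ, hsmall⟩ := exists_small_plan f hη
  refine ⟨δ, hδ, fun x u y h hw => ?_⟩
  obtain ⟨x₁, u₁, y₁, h₁, hp, hE⟩ := H.exists_isPlan_of_mem h
  obtain ⟨x', u', y', h', h0', hf', hcost⟩ := hsmall x₁ u₁ y₁ h₁ hp.terminal
    (lt_of_eq_of_lt (congrArg norm hE) hw)
  have hL := H.two_h_le
  -- The cheap trajectory has the right E x at index h but possibly another window. Only its tail is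
  -- used, and the cost does not see the window.
  have hc := DescriptorSystem.concat_mem_fullBehavior h
    (DescriptorSystem.shift_mem_fullBehavior h' M.h) (t := M.h) (hf'.trans hE)
  refine ⟨fun k => if k < M.h then u k else u' (M.h + (k - M.h)),
    fun k => if k < M.h then y k else y' (M.h + (k - M.h)),
    ⟨⟨_, hc⟩, fun i => ?_, fun k hk => ?_⟩, lt_of_eq_of_lt ?_ hcost⟩
  · simp [window]
  · simp only [show ¬ k < M.h by omega, if_false]
    exact h0' _ (by omega)
  · refine cost_congr fun k hk _ => ?_
    simp only [show ¬ k < M.h by omega, if_false, Nat.add_sub_cancel' hk, and_self]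

/-- A cheap initial plan bounds the optimal value, and hence every stage cost from time 0 on, by η.
-/
lemma isStable (hQ : M.Q.PosDef) (hR : M.R.PosDef) : M.IsStable := by
  intro ε hε
  obtain ⟨η, hη, hsmall⟩ := H.exists_stage_small hQ hR hε
  obtain ⟨δ₁, hδ₁, h₁⟩ := H.exists_small_plan_of_state hη
  obtain ⟨δ₂, hδ₂, h₂⟩ := H.exists_small_plan_of_window hη
  refine ⟨min δ₁ δ₂, lt_min hδ₁ hδ₂, fun x u y hcl hini t => ?_⟩
  obtain ⟨V, hV0, hV, hVle⟩ := H.exists_value hQ hR hcl.2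
  have hV0η : V 0 < η := by
    obtain ⟨u', y', hp, hcost⟩ : ∃ u' y', M.IsPlan (M.window u y 0) u' y' ∧ M.cost u' y' < η := by
      rcases hini with hini | hini
      · exact h₁ x u y hcl.1 (hini.trans_le (min_le_left _ _))
      · exact h₂ x u y hcl.1 (hini.trans_le (min_le_right _ _))
    exact (hVle u' y' hp).trans_lt hcost
  have hanti : Antitone V := antitone_nat_of_succ_le fun t =>
    le_trans (le_add_of_nonneg_right (stage_nonneg hQ hR _ _)) (hV t)
  refine hsmall x u y hcl.1 (t + M.h) fun k hk => ?_
  obtain ⟨j, rfl⟩ := Nat.exists_eq_add_of_le' ((Nat.le_add_left _ _).trans hk)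
  have h3 := hV j
  have h4 := hV0 (j + 1)
  have h5 := hanti (Nat.zero_le j)
  linarith

/-- The optimal value decreases and is nonnegative, so its increments, and with them the stage
costs, tend to zero. -/
lemma tendsto_zero (hQ : M.Q.PosDef) (hR : M.R.PosDef) {x : ℕ → Fin n → ℝ} {u : ℕ → Fin m → ℝ}
    {y : ℕ → Fin p → ℝ} (hcl : M.IsClosedLoop x u y) :
    Tendsto (fun t => (x (t + M.h), u (t + M.h), y (t + M.h))) atTop (𝓝 0) := by
  obtain ⟨V, hV0, hV, -⟩ := H.exists_value hQ hR hcl.2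
  have hanti : Antitone V := antitone_nat_of_succ_le fun t =>
    le_trans (le_add_of_nonneg_right (stage_nonneg hQ hR _ _)) (hV t)
  have hlim : Tendsto V atTop (𝓝 (⨅ t, V t)) :=
    tendsto_atTop_ciInf hanti ⟨0, by rintro _ ⟨t, rfl⟩; exact hV0 t⟩
  have hdiff : Tendsto (fun t => V t - V (t + 1)) atTop (𝓝 0) := by
    have := hlim.sub (hlim.comp (tendsto_add_atTop_nat 1))
    rwa [sub_self] at this
  rw [NormedAddGroup.tendsto_nhds_zero]
  intro ε hε
  obtain ⟨η, hη, hsmall⟩ := H.exists_stage_small hQ hR hε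
  obtain ⟨T, hT⟩ := eventually_atTop.1 (hdiff.eventually_lt_const hη)
  filter_upwards [eventually_ge_atTop T] with t ht
  refine hsmall x u y hcl.1 (t + M.h) fun k hk => ?_
  obtain ⟨j, rfl⟩ := Nat.exists_eq_add_of_le' ((Nat.le_add_left _ _).trans hk)
  have h1 := hT j (by omega)
  have h2 := hV j
  linarith

/-- Every closed loop converges, so only its existence is at stake: its first step needs
feasibility, and conversely feasibility starts an infinite run. -/
lemma domainOfAttraction_eq (hQ : M.Q.PosDef) (hR : M.R.PosDef) :
    M.domainOfAttraction = M.feasibleInitialValues := by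
  ext w
  constructor
  · rintro ⟨⟨x, u, y, hcl, rfl⟩, -⟩
    obtain ⟨uh, yh, α, hopt, -⟩ := hcl.2 0
    exact ⟨⟨(u, y), ⟨x, hcl.1⟩, fun k => by simp [window], fun k => by simp [window]⟩,
      uh, yh, α, hopt.1⟩
  · rintro ⟨⟨⟨u, y⟩, -, hu, hy⟩, hfeas⟩
    have hw : M.window u y 0 = w :=
      Prod.ext (funext fun i => by simp [window, hu]) (funext fun i => by simp [window, hy])
    obtain ⟨u', y', heq, hrun⟩ := H.exists_isRun hQ hR (hw.symm ▸ hfeas)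
      (fun k hk => absurd hk (Nat.not_lt_zero k) : M.IsRunUpTo u y 0)
    have hw' : M.window u' y' 0 = w := by
      rw [← hw]
      exact Prod.ext (funext fun i => (heq _ (by omega)).1) (funext fun i => (heq _ (by omega)).2)
    obtain ⟨x, hx⟩ := H.mem_manifest_of_isRun hrun
    exact ⟨⟨x, u', y', ⟨hx, hrun⟩, hw'⟩, fun x u y hcl _ => H.tendsto_zero hQ hR hcl⟩

end Admissible

end MPCScheme

theorem proposition2 {n m p : ℕ} (M : MPCScheme n m p)
    (hreg : M.sys.IsRegular) (hctrl : M.sys.IsRControllable) (hobs : M.sys.IsRObservable)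
    (hQ : M.Q.PosDef) (hR : M.R.PosDef)
    (hdata : ((fun k : Fin M.T => M.ubar k), (fun k : Fin M.T => M.ybar k))
      ∈ M.sys.restrictedManifestBehavior M.T)
    (hpe : IsPersistentlyExciting M.T M.ubar (M.L + 2 * (M.sys.q + M.sys.s - 1)))
    (hL : 2 * M.sys.q + 3 * M.sys.s ≤ M.L + 2) :
    -- recursive feasibility: after every finite run of the scheme the problem is feasible again,
    -- and the run can be continued for all times
    (∀ u y, M.IsFeasible (M.window u y 0) → ∀ t, M.IsRunUpTo u y t →
      M.IsFeasible (M.window u y t) ∧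
      ∃ u₂ y₂, (∀ k < t + M.h, u₂ k = u k ∧ y₂ k = y k) ∧ M.IsRun u₂ y₂) ∧
    -- the closed loop produces trajectories of the system
    (∀ u y, M.IsRun u y → (u, y) ∈ M.sys.manifestBehavior) ∧
    -- asymptotic stability of the origin
    M.IsStable ∧ M.domainOfAttraction = M.feasibleInitialValues := by
  obtain ⟨W, hWc, hWo⟩ := hreg.hasQuasiWeierstrassForm.exists_coordinates M.sys hctrl hobs
  have H : M.Admissible := ⟨W, hWc, hWo, hdata, hpe, hL⟩
  exact ⟨fun u y h0 t h => ⟨H.isFeasible_of_isRunUpTo h0 h, H.exists_isRun hQ hR h0 h⟩,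
    fun u y h => H.mem_manifest_of_isRun h, H.isStable hQ hR, H.domainOfAttraction_eq hQ hR⟩
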